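/- For a finite-dimensional complex Hilbert space $\mathcal H$ let $L(\mathcal H)$ be the linear operators on $\mathcal H$ and $\mathsf{St}(\mathcal H)=\{\rho\in L(\mathcal H):\rho\ge 0,\ \operatorname{Tr}\rho=1\}$. A state space symmetry $\mathcal S:\mathsf{St}(\mathcal H)\to\mathsf{St}(\mathcal K)$ is a bijection with $\mathcal S(p\rho+(1-p)\sigma)=p\,\mathcal S(\rho)+(1-p)\,\mathcal S(\sigma)$ for all states $\rho,\sigma$ and all $p\in[0,1]$; it extends uniquely to a linear map $L(\mathcal H)\to L(\mathcal K)$, denoted by the same letter. It is called unitary if it has the form $\rho\mapsto U\rho U^\dagger$, and antiunitary if it has the form $\rho\mapsto U\rho^TU^\dagger$, for some unitary operator $U:\mathcal H\to\mathcal K$, where $\rho^T$ is the transpose with respect to a fixed but arbitrary orthonormal basis. Let $\mathsf{Op}(\mathcal H,\mathcal K)$ be the set of quantum operations, i.e. of completely positive linear maps $\mathcal Q:L(\mathcal H)\to L(\mathcal K)$ with $\operatorname{Tr}\mathcal Q(\rho)\le\operatorname{Tr}\rho$ for all $\rho\ge 0$. **Theorem (Wigner's theorem for quantum operations).** Let $\mathcal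 H_{\rm in},\mathcal H_{\rm out},\mathcal K_{\rm in},\mathcal K_{\rm out}$ be finite-dimensional complex Hilbert spaces, with $\mathcal H_{\rm in}$ and $\mathcal H_{\rm out}$ nonzero. Let $\mathcal S:\mathsf{Op}(\mathcal H_{\rm in},\mathcal H_{\rm out})\to\mathsf{Op}(\mathcal K_{\rm in},\mathcal K_{\rm out})$ be a bijection such that $\mathcal S(p\,\mathcal Q+(1-p)\,\mathcal R)=p\,\mathcal S(\mathcal Q)+(1-p)\,\mathcal S(\mathcal R)$ for all quantum operations $\mathcal Q,\mathcal R$ and all $p\in[0,1]$, and $\mathcal S(0)=0$. Then there are state space symmetries $\mathcal S_1:\mathsf{St}(\mathcal K_{\rm in})\to\mathsf{St}(\mathcal H_{\rm in})$ and $\mathcal S_2:\mathsf{St}(\mathcal H_{\rm out})\to\mathsf{St}(\mathcal K_{\rm out})$, either both unitary or both antiunitary, such that $\mathcal S(\mathcal Q)=\mathcal S_2\circ\mathcal Q\circ\mathcal S_1$ for every $\mathcal Q\in\mathsf{Op}(\mathcal H_{\rm in},\mathcal H_{\rm out})$. In particular $\dim\mathcal H_{\rm in}=\dim\mathcal K_{\rm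 in}$ and $\dim\mathcal H_{\rm out}=\dim\mathcal K_{\rm out}$. -/

import Mathlib

open scoped CStarAlgebra

namespace QuantumOp

noncomputable section

/-- `L(H)`, the linear operators on `H` (on a finite-dimensional space all of them are bounded). It
carries Mathlib's C⋆-algebra structure and Loewner order (`0 ≤ A` iff `A` is positive
semidefinite). -/
abbrev Operators (H : Type*) [NormedAddCommGroup H] [InnerProductSpace ℂ H] : Type _ :=
  H →L[ℂ] H

/-- `Map(H, K)`, the linear maps from `L(H)` to `L(K)`. -/
abbrev SuperOp (H K : Type*) [NormedAddCommGroup H] [InnerProductSpace ℂ H]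
    [NormedAddCommGroup K] [InnerProductSpace ℂ K] : Type _ :=
  Operators H →ₗ[ℂ] Operators K

/-- The trace of an operator. -/
def tr {H : Type*} [NormedAddCommGroup H] [InnerProductSpace ℂ H] (ρ : Operators H) : ℂ :=
  LinearMap.trace ℂ H (ρ : H →ₗ[ℂ] H)

/-- `St(H)`, the density matrices: positive semidefinite operators of trace one. -/
def states (H : Type*) [NormedAddCommGroup H] [InnerProductSpace ℂ H] : Set (Operators H) :=
  {ρ | 0 ≤ ρ ∧ tr ρ = 1}

/-- `Op(H, K)`, the quantum operations: completely positive, trace-non-increasing linear maps from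
`L(H)` to `L(K)`. The trace of a positive semidefinite operator is real, so comparing real parts
compares the traces. -/
def operations (H K : Type*)
    [NormedAddCommGroup H] [InnerProductSpace ℂ H] [CompleteSpace H]
    [NormedAddCommGroup K] [InnerProductSpace ℂ K] [CompleteSpace K] : Set (SuperOp H K) :=
  {Q | (∃ Φ : Operators H →CP Operators K, Φ.toLinearMap = Q) ∧
    ∀ ρ : Operators H, 0 ≤ ρ → (tr (Q ρ)).re ≤ (tr ρ).re}

/-- `S` restricts to a state space symmetry `St(H) → St(K)`: a bijection between the sets of density
matrices that is consistent with randomisations. -/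
structure IsStateSymmetry {H K : Type*}
    [NormedAddCommGroup H] [InnerProductSpace ℂ H]
    [NormedAddCommGroup K] [InnerProductSpace ℂ K]
    (S : Operators H → Operators K) : Prop where
  bijOn : Set.BijOn S (states H) (states K)
  map_mix : ∀ ρ ∈ states H, ∀ σ ∈ states H, ∀ p : ℝ, 0 ≤ p → p ≤ 1 →
    S ((p : ℂ) • ρ + ((1 - p : ℝ) : ℂ) • σ) = (p : ℂ) • S ρ + ((1 - p : ℝ) : ℂ) • S σ

/-- `U A U†` for a unitary `U : H → K` and an operator `A` on `H`. -/
def unitaryConj {H K : Type*}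
    [NormedAddCommGroup H] [InnerProductSpace ℂ H] [CompleteSpace H]
    [NormedAddCommGroup K] [InnerProductSpace ℂ K] [CompleteSpace K]
    (U : H ≃ₗᵢ[ℂ] K) (A : Operators H) : Operators K :=
  (U : H →L[ℂ] K) ∘L A ∘L ContinuousLinearMap.adjoint (U : H →L[ℂ] K)

/-- The transpose of an operator with respect to an orthonormal basis. -/
def transposeIn {H : Type*} [NormedAddCommGroup H] [InnerProductSpace ℂ H] [FiniteDimensional ℂ H]
    {ι : Type*} [Fintype ι] [DecidableEq ι] (b : OrthonormalBasis ι ℂ H) (A : Operators H) :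
    Operators H :=
  LinearMap.toContinuousLinearMap (Matrix.toLin b.toBasis b.toBasis
    (LinearMap.toMatrix b.toBasis b.toBasis (A : H →ₗ[ℂ] H)).transpose)

/-- `S` acts on states as a unitary transformation `ρ ↦ U ρ U†`. -/
def IsUnitaryOnStates {H K : Type*}
    [NormedAddCommGroup H] [InnerProductSpace ℂ H] [CompleteSpace H]
    [NormedAddCommGroup K] [InnerProductSpace ℂ K] [CompleteSpace K]
    (S : Operators H → Operators K) : Prop :=
  ∃ U : H ≃ₗᵢ[ℂ] K, ∀ ρ ∈ states H, S ρ = unitaryConj U ρ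

/-- `S` acts on states as an antiunitary transformation `ρ ↦ U ρᵀ U†`, with `U` unitary. The basis
that defines the transpose is arbitrary (the unitary `U` depends on it). -/
def IsAntiunitaryOnStates {H K : Type*}
    [NormedAddCommGroup H] [InnerProductSpace ℂ H] [FiniteDimensional ℂ H] [CompleteSpace H]
    [NormedAddCommGroup K] [InnerProductSpace ℂ K] [CompleteSpace K]
    (S : Operators H → Operators K) : Prop :=
  ∀ b : OrthonormalBasis (Fin (Module.finrank ℂ H)) ℂ H,
    ∃ U : H ≃ₗᵢ[ℂ] K, ∀ ρ ∈ states H, S ρ = unitaryConj U (transposeIn b ρ)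

/-- `S` restricts to an operation space symmetry `Op(H₁, H₂) → Op(K₁, K₂)`: a bijection between the
sets of quantum operations that is consistent with randomisations and preserves the null
operation. -/
structure IsOperationSymmetry {H₁ H₂ K₁ K₂ : Type*}
    [NormedAddCommGroup H₁] [InnerProductSpace ℂ H₁] [CompleteSpace H₁]
    [NormedAddCommGroup H₂] [InnerProductSpace ℂ H₂] [CompleteSpace H₂]
    [NormedAddCommGroup K₁] [InnerProductSpace ℂ K₁] [CompleteSpace K₁]
    [NormedAddCommGroup K₂] [InnerProductSpace ℂ K₂] [CompleteSpace K₂]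
    (S : SuperOp H₁ H₂ → SuperOp K₁ K₂) : Prop where
  bijOn : Set.BijOn S (operations H₁ H₂) (operations K₁ K₂)
  map_mix : ∀ Q ∈ operations H₁ H₂, ∀ R ∈ operations H₁ H₂, ∀ p : ℝ, 0 ≤ p → p ≤ 1 →
    S ((p : ℂ) • Q + ((1 - p : ℝ) : ℂ) • R) = (p : ℂ) • S Q + ((1 - p : ℝ) : ℂ) • S R
  map_null : S 0 = 0

end

end QuantumOp

/-!
The proof linearises the symmetry, finds its action on Kraus operators from its action on Choi
operators, and finds the input part of that action from its action on effects.

* **Linearity.** An affine map that fixes `0`, on a convex subset of the positive cone that meets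
  every ray, extends to a linear map (`exists_linear_extension_of_affine`). Applied to a symmetry
  and its inverse in the Choi picture, this gives a linear isomorphism `T` of the spaces of linear
  maps that preserves the set of quantum operations (`IsOperationSymmetry.exists_linearEquiv`).

* **Order isomorphisms.** A unital order isomorphism between the algebras of operators on
  finite-dimensional spaces preserves the extreme points of the set of effects, i.e. the
  projections. By the spectral theorem it is a Jordan homomorphism (`IsOrderIso.map_jordan`), and by
  Herstein's argument it is multiplicative or antimultiplicative (`mul_or_antimul_of_jordan`); so it
  sends `|x⟩⟨x|` to `|u x⟩⟨u x|` with `u` unitary or antiunitary (`IsOrderIso.exists_isometry`). An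
  order isomorphism that need not be unital becomes unital after a congruence, and so has the same
  form with `u` merely invertible (`IsOrderIso.exists_semilinear`).

* **Kraus operators.** By Choi's theorem (`completelyPositive_iff`) `T` is an order isomorphism of
  Choi operators, so there is a linear or antilinear bijection `A` of the Kraus operators such that
  `T` sends `X ↦ V X V†` to `X ↦ (A V) X (A V)†` (`IsOperationIso.exists_kraus_map`).

* **Effects.** A quantum operation is a completely positive map whose effect is at most the
  identity (`mem_operations_iff`). The effect of `Q` is determined by the operations whose sum with
  `Q` is an operation, so `T` induces a unital order isomorphism of effects
  (`IsOperationIso.exists_effect_iso`), implemented by some unitary or antiunitary `u`. As the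
  effect of `X ↦ V X V†` is `V† V`, this means `‖A V (u x)‖ = ‖V x‖` for all `V` and `x`.

* **Polarisation.** If `A` and `u` are both linear or both antilinear, polarisation in `V` and in
  `x` gives `Re ⟪A V (u x), A W (u y)⟫ = Re ⟪V x, W y⟫`. Hence `A V (u x)` depends only on `V x`, so
  that `A V = U ∘ V ∘ u⁻¹` with an isometry `U` of the same type (`exists_output_isometry`). If the
  types differ, polarisation exchanges `x` and `y`, which is impossible unless the input space is a
  line (`norm_apply_of_mixed_type`); there the type of `u` can be changed. This is why the two state
  space symmetries are both unitary or both antiunitary.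
-/

namespace QuantumOp

set_option linter.unusedSectionVars false

open ContinuousLinearMap InnerProductSpace Metric
open scoped InnerProductSpace ComplexConjugate ComplexStarModule

noncomputable section

/-! ### Unital order isomorphisms are Jordan homomorphisms -/

section Core

variable {H K : Type*}
    [NormedAddCommGroup H] [InnerProductSpace ℂ H] [FiniteDimensional ℂ H] [CompleteSpace H]
    [NormedAddCommGroup K] [InnerProductSpace ℂ K] [FiniteDimensional ℂ K] [CompleteSpace K]

lemma rankOne_self_nonneg (x : H) : 0 ≤ rankOne ℂ x x :=
  (nonneg_iff_isPositive _).2 (isPositive_rankOne_self x)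

/-- A positive linear map between operator algebras commutes with the adjoint. -/
lemma map_star_of_nonneg {T : Operators H →ₗ[ℂ] Operators K} (hT : ∀ X, 0 ≤ X → 0 ≤ T X)
    (X : Operators H) : T (star X) = star (T X) := by
  have hX : X ∈ Submodule.span ℂ {x : Operators H | 0 ≤ x} := by
    rw [CStarAlgebra.span_nonneg]; trivial
  induction hX using Submodule.span_induction with
  | mem x hx =>
    rw [(IsSelfAdjoint.of_nonneg hx).star_eq, (IsSelfAdjoint.of_nonneg (hT x hx)).star_eq]
  | zero => simp
  | add x y _ _ hx hy => rw [star_add, map_add, map_add, star_add, hx, hy]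
  | smul a x _ hx => rw [star_smul, map_smul, map_smul, star_smul, hx]

/-- `T` is an isomorphism of ordered vector spaces. -/
def IsOrderIso (T : Operators H ≃ₗ[ℂ] Operators K) : Prop := ∀ X, 0 ≤ T X ↔ 0 ≤ X

lemma IsOrderIso.symm {T : Operators H ≃ₗ[ℂ] Operators K} (hT : IsOrderIso T) :
    IsOrderIso T.symm := fun X => by rw [← hT, T.apply_symm_apply]

lemma IsOrderIso.le_iff {T : Operators H ≃ₗ[ℂ] Operators K} (hT : IsOrderIso T)
    (X Y : Operators H) : T X ≤ T Y ↔ X ≤ Y := by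
  rw [← sub_nonneg, ← map_sub, hT, sub_nonneg]

lemma IsOrderIso.map_star {T : Operators H ≃ₗ[ℂ] Operators K} (hT : IsOrderIso T)
    (X : Operators H) : T (star X) = star (T X) :=
  map_star_of_nonneg (T := T.toLinearMap) (fun X hX => (hT X).2 hX) X

lemma nonneg_inter_closedBall :
    {x : Operators H | 0 ≤ x} ∩ closedBall 0 1 = Set.Icc 0 1 := by
  ext x
  simp only [Set.mem_inter_iff, Set.mem_ofPred_eq, mem_closedBall_zero_iff, Set.mem_Icc]
  exact ⟨fun h => ⟨h.1, (CStarAlgebra.norm_le_one_iff_of_nonneg x h.1).1 h.2⟩,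
    fun h => ⟨h.1, (CStarAlgebra.norm_le_one_iff_of_nonneg x h.1).2 h.2⟩⟩

/-- Projections are the extreme points of the set of effects, so unital order isomorphisms
preserve them. -/
lemma IsOrderIso.isStarProjection {T : Operators H ≃ₗ[ℂ] Operators K} (hT : IsOrderIso T)
    (h1 : T 1 = 1) {P : Operators H} (hP : IsStarProjection P) : IsStarProjection (T P) := by
  rw [isStarProjection_iff_mem_extremePoints_setOfPred_nonneg_inter_unitClosedBall,
    nonneg_inter_closedBall] at hP ⊢
  have himg : (T.restrictScalars ℝ) '' Set.Icc 0 1 = Set.Icc 0 1 := by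
    ext Y
    constructor
    · rintro ⟨X, ⟨h0, h1'⟩, rfl⟩
      exact ⟨(hT X).2 h0, by have := (hT.le_iff X 1).2 h1'; rwa [h1] at this⟩
    · rintro ⟨h0, h1'⟩
      refine ⟨T.symm Y, ⟨(hT.symm Y).2 h0, ?_⟩, T.apply_symm_apply Y⟩
      rw [← hT.le_iff, T.apply_symm_apply, h1]
      exact h1'
  rw [← himg, ← image_extremePoints]
  exact ⟨P, hP, rfl⟩

lemma IsOrderIso.mul_eq_zero {T : Operators H ≃ₗ[ℂ] Operators K} (hT : IsOrderIso T)
    (h1 : T 1 = 1) {P Q : Operators H} (hP : IsStarProjection P) (hQ : IsStarProjection Q)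
    (hPQ : P * Q = 0) : T P * T Q = 0 := by
  have : IsAddTorsionFree (Operators K) := .of_isTorsionFree ℂ _
  have hsum := hT.isStarProjection h1 (hP.add hQ hPQ)
  have hp := (hT.isStarProjection h1 hP).isIdempotentElem
  have hq := (hT.isStarProjection h1 hQ).isIdempotentElem
  rw [map_add] at hsum
  have h2 := (IsIdempotentElem.add_iff hp hq).1 hsum.isIdempotentElem
  exact IsIdempotentElem.mul_eq_zero_of_anticommute hp h2

/-- Spectral decomposition of a self-adjoint operator. -/
lemma exists_eq_sum_rankOne {X : Operators H} (hX : IsSelfAdjoint X) :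
    ∃ (l : Fin (Module.finrank ℂ H) → ℝ) (b : OrthonormalBasis (Fin (Module.finrank ℂ H)) ℂ H),
      X = ∑ i, (l i : ℂ) • rankOne ℂ (b i) (b i) := by
  have hs : (X : H →ₗ[ℂ] H).IsSymmetric := isSelfAdjoint_iff_isSymmetric.1 hX
  refine ⟨hs.eigenvalues rfl, hs.eigenvectorBasis rfl, ?_⟩
  ext v
  conv_lhs => rw [← (hs.eigenvectorBasis rfl).sum_repr' v]
  simp only [map_sum, map_smul, _root_.sum_apply, _root_.smul_apply,
    rankOne_apply]
  refine Finset.sum_congr rfl fun i _ => ?_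
  rw [smul_comm]
  congr 1
  exact hs.apply_eigenvectorBasis rfl i

lemma IsOrderIso.map_mul_self {T : Operators H ≃ₗ[ℂ] Operators K} (hT : IsOrderIso T)
    (h1 : T 1 = 1) {X : Operators H} (hX : IsSelfAdjoint X) : T (X * X) = T X * T X := by
  obtain ⟨l, b, rfl⟩ := exists_eq_sum_rankOne hX
  have hproj : ∀ i, IsStarProjection (rankOne ℂ (b i) (b i)) := fun i =>
    isStarProjection_rankOne_self (b.norm_eq_one i)
  have hmul : ∀ i j, T (rankOne ℂ (b i) (b i) * rankOne ℂ (b j) (b j)) =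
      T (rankOne ℂ (b i) (b i)) * T (rankOne ℂ (b j) (b j)) := by
    intro i j
    by_cases hij : i = j
    · subst hij
      rw [(hproj i).isIdempotentElem.eq, (hT.isStarProjection h1 (hproj i)).isIdempotentElem.eq]
    · have h0 : rankOne ℂ (b i) (b i) * rankOne ℂ (b j) (b j) = 0 := by
        rw [mul_def, rankOne_comp_rankOne, b.inner_eq_zero hij, zero_smul]
      rw [h0, map_zero, hT.mul_eq_zero h1 (hproj i) (hproj j) h0]
  simp only [map_sum, map_smul, Finset.sum_mul_sum, smul_mul_assoc, mul_smul_comm, hmul]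

/-- A unital order isomorphism is a Jordan homomorphism. -/
lemma IsOrderIso.map_jordan {T : Operators H ≃ₗ[ℂ] Operators K} (hT : IsOrderIso T)
    (h1 : T 1 = 1) (X Y : Operators H) : T (X * Y + Y * X) = T X * T Y + T Y * T X := by
  have hsa : ∀ X Y : Operators H, IsSelfAdjoint X → IsSelfAdjoint Y →
      T (X * Y + Y * X) = T X * T Y + T Y * T X := by
    intro X Y hX hY
    have h := hT.map_mul_self h1 (hX.add hY)
    simp only [map_add, add_mul, mul_add, hT.map_mul_self h1 hX, hT.map_mul_self h1 hY] at h ⊢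
    have h' : T (X * Y) + T (Y * X) = (T X * T X + T (Y * X) + (T (X * Y) + T Y * T Y))
      - T X * T X - T Y * T Y := by abel
    rw [h', h]; abel
  have hX : X ∈ Submodule.span ℂ (selfAdjoint (Operators H) : Set (Operators H)) := by
    rw [span_selfAdjoint]; trivial
  have hY : Y ∈ Submodule.span ℂ (selfAdjoint (Operators H) : Set (Operators H)) := by
    rw [span_selfAdjoint]; trivial
  induction hX, hY using Submodule.span_induction₂ with
  | mem_mem x y hx hy => exact hsa x y hx hy
  | zero_left y _ => simp
  | zero_right x _ => simp
  | add_left x y z _ _ _ hx hy =>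
    have : (x + y) * z + z * (x + y) = (x * z + z * x) + (y * z + z * y) := by noncomm_ring
    rw [this, map_add, hx, hy, map_add]; noncomm_ring
  | add_right x y z _ _ _ hy hz =>
    have : x * (y + z) + (y + z) * x = (x * y + y * x) + (x * z + z * x) := by noncomm_ring
    rw [this, map_add, hy, hz, map_add]; noncomm_ring
  | smul_left r x y _ _ h =>
    rw [smul_mul_assoc, mul_smul_comm, ← smul_add, map_smul, h, map_smul, smul_mul_assoc,
      mul_smul_comm, smul_add]
  | smul_right r x y _ _ h =>
    rw [smul_mul_assoc, mul_smul_comm, ← smul_add, map_smul, h, map_smul, smul_mul_assoc,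
      mul_smul_comm, smul_add]

end Core

/-! ### Jordan homomorphisms between operator algebras -/

section Jordan

variable {A B : Type*} [Ring A] [Algebra ℂ A] [Ring B] [Algebra ℂ B]

lemma jordan_map_triple_self (f : A →ₗ[ℂ] B)
    (hf : ∀ x y, f (x * y + y * x) = f x * f y + f y * f x) (a b : A) :
    f (a * b * a) = f a * f b * f a := by
  have h1 := hf a (a * b + b * a)
  have h2 := hf (a * a + a * a) b
  rw [hf a b] at h1
  rw [map_add f (a * a) (a * a)] at h2
  -- with `x ∘ y = xy + yx`, this is `4aba = 2 a ∘ (a ∘ b) - (a ∘ a) ∘ b`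
  have h3 : (4 : ℂ) • (a * b * a) =
      (2 : ℂ) • (a * (a * b + b * a) + (a * b + b * a) * a)
        - ((a * a + a * a) * b + b * (a * a + a * a)) := by
    rw [show (4 : ℂ) = 1 + 1 + 1 + 1 by norm_num, show (2 : ℂ) = 1 + 1 by norm_num]
    simp only [add_smul, one_smul]
    noncomm_ring
  have h4 : (4 : ℂ) • f (a * b * a) = (4 : ℂ) • (f a * f b * f a) := by
    rw [← map_smul, h3, map_sub, map_smul, h1, h2,
      show (4 : ℂ) = 1 + 1 + 1 + 1 by norm_num, show (2 : ℂ) = 1 + 1 by norm_num]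
    simp only [add_smul, one_smul]
    have h5 : f (a * a) + f (a * a) = f a * f a + f a * f a := by rw [← map_add, hf]
    rw [h5]
    noncomm_ring
  exact smul_right_injective B (by norm_num : (4 : ℂ) ≠ 0) h4

lemma jordan_map_triple (f : A →ₗ[ℂ] B)
    (hf : ∀ x y, f (x * y + y * x) = f x * f y + f y * f x) (a b c : A) :
    f (a * b * c + c * b * a) = f a * f b * f c + f c * f b * f a := by
  have h : a * b * c + c * b * a = (a + c) * b * (a + c) - a * b * a - c * b * c := by
    noncomm_ring
  rw [h, map_sub, map_sub]
  simp only [jordan_map_triple_self f hf, map_add]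
  noncomm_ring

/-- For a Jordan homomorphism, the defects of being multiplicative and of being antimultiplicative
annihilate each other. Both sides of `f (ab x ba + ba x ab) = f (a (b x b) a + b (a x a) b)` are
expanded with the triple identities. -/
lemma jordan_defect (f : A →ₗ[ℂ] B)
    (hf : ∀ x y, f (x * y + y * x) = f x * f y + f y * f x) (a b x : A) :
    (f (a * b) - f a * f b) * f x * (f (a * b) - f b * f a) +
      (f (a * b) - f b * f a) * f x * (f (a * b) - f a * f b) = 0 := by
  have h1 := jordan_map_triple f hf (a * b) x (b * a)
  have h2 : f (a * (b * x * b) * a) = f a * (f b * f x * f b) * f a := by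
    rw [jordan_map_triple_self f hf, jordan_map_triple_self f hf]
  have h3 : f (b * (a * x * a) * b) = f b * (f a * f x * f a) * f b := by
    rw [jordan_map_triple_self f hf, jordan_map_triple_self f hf]
  have h4 : a * b * x * (b * a) + b * a * x * (a * b) =
      a * (b * x * b) * a + b * (a * x * a) * b := by noncomm_ring
  have hba : f (b * a) = f a * f b + f b * f a - f (a * b) := by
    rw [← hf, map_add]; abel
  rw [h4, map_add, h2, h3, hba] at h1
  generalize f (a * b) = p at *
  generalize f a = r at *
  generalize f b = s at *
  generalize f x = t at *
  have h5 : (p - r * s) * t * (p - s * r) + (p - s * r) * t * (p - r * s) =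
     r * (s * t * s) * r + s * (r * t * r) * s -
      (p * t * (r * s + s * r - p) + (r * s + s * r - p) * t * p) := by noncomm_ring
  rw [h5, h1, sub_self]

end Jordan

section Core

variable {H K : Type*}
    [NormedAddCommGroup H] [InnerProductSpace ℂ H] [FiniteDimensional ℂ H] [CompleteSpace H]
    [NormedAddCommGroup K] [InnerProductSpace ℂ K] [FiniteDimensional ℂ K] [CompleteSpace K]

lemma eq_zero_or_eq_zero_of_mul_add_mul (u v : Operators K)
    (h : ∀ x : Operators K, u * x * v + v * x * u = 0) : u = 0 ∨ v = 0 := by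
  -- primeness of the algebra of operators, tested on rank-one operators
  have hprime : ∀ a b : Operators K, (∀ x, a * x * b = 0) → a = 0 ∨ b = 0 := by
    intro a b hab
    by_contra! hne
    obtain ⟨x, hx⟩ := DFunLike.ne_iff.1 hne.1
    obtain ⟨y, hy⟩ := DFunLike.ne_iff.1 hne.2
    have h0 := DFunLike.congr_fun (hab (rankOne ℂ x (b y))) y
    change a (inner ℂ (b y) (b y) • x) = 0 at h0
    rw [map_smul, smul_eq_zero, inner_self_eq_zero] at h0
    exact h0.elim hy hx
  have key : ∀ x, u * x * v = 0 := by
    intro x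
    have hz : u * x * v = -(v * x * u) := eq_neg_of_add_eq_zero_left (h x)
    refine or_self_iff.1 (hprime _ _ fun y => ?_)
    have h' : ∀ w, u * w * v = -(v * w * u) := fun w => eq_neg_of_add_eq_zero_left (h w)
    -- the same product is `±v x v y u x u`
    have e1 : u * x * v * y * (u * x * v) = v * x * v * y * u * x * u := by
      calc u * x * v * y * (u * x * v) = -(v * x * (u * (y * u * x) * v)) := by
            nth_rw 1 [hz]; noncomm_ring
        _ = v * x * v * y * u * x * u := by rw [h' (y * u * x)]; noncomm_ring
    have e2 : u * x * v * y * (u * x * v) = -(v * x * v * y * u * x * u) := by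
      calc u * x * v * y * (u * x * v) = v * x * (u * y * v) * x * u := by
            rw [hz]; noncomm_ring
        _ = -(v * x * v * y * u * x * u) := by rw [h' y]; noncomm_ring
    have : IsAddTorsionFree (Operators K) := .of_isTorsionFree ℂ _
    exact self_eq_neg.1 (e2.trans (congrArg Neg.neg e1.symm))
  exact hprime u v key

/-- A bijective Jordan homomorphism between operator algebras is multiplicative or
antimultiplicative. -/
lemma mul_or_antimul_of_jordan (T : Operators H ≃ₗ[ℂ] Operators K)
    (hT : ∀ X Y, T (X * Y + Y * X) = T X * T Y + T Y * T X) :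
    (∀ X Y, T (X * Y) = T X * T Y) ∨ (∀ X Y, T (X * Y) = T Y * T X) := by
  have hpair : ∀ X Y, T (X * Y) = T X * T Y ∨ T (X * Y) = T Y * T X := by
    intro X Y
    rw [← sub_eq_zero, ← sub_eq_zero (b := T Y * T X)]
    refine eq_zero_or_eq_zero_of_mul_add_mul _ _ fun Z => ?_
    have := jordan_defect T.toLinearMap hT X Y (T.symm Z)
    simpa using this
  -- an additive group is not the union of two proper subgroups; this is used twice
  have hX : ∀ X, (∀ Y, T (X * Y) = T X * T Y) ∨ (∀ Y, T (X * Y) = T Y * T X) := by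
    intro X
    by_contra! h
    obtain ⟨⟨Y, hY⟩, Z, hZ⟩ := h
    have hY' := (hpair X Y).resolve_left hY
    have hZ' := (hpair X Z).resolve_right hZ
    rcases hpair X (Y + Z) with h | h
    · rw [mul_add, map_add, map_add, mul_add, hZ', add_left_inj] at h
      exact hY h
    · rw [mul_add, map_add, map_add, add_mul, hY', add_right_inj] at h
      exact hZ h
  by_contra! h
  obtain ⟨⟨X, Y, hXY⟩, X', Y', hXY'⟩ := h
  have h1 := (hX X).resolve_left fun h => hXY (h Y)
  have h2 := (hX X').resolve_right fun h => hXY' (h Y')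
  rcases hX (X + X') with h | h
  · have := h Y
    rw [add_mul, map_add, map_add, add_mul, h2, add_left_inj] at this
    exact hXY this
  · have := h Y'
    rw [add_mul, map_add, map_add, mul_add, h1, add_right_inj] at this
    exact hXY' this

end Core

/-! ### Antiunitaries and the implementation of order isomorphisms -/

section Core

variable {H K : Type*}
    [NormedAddCommGroup H] [InnerProductSpace ℂ H] [FiniteDimensional ℂ H] [CompleteSpace H]
    [NormedAddCommGroup K] [InnerProductSpace ℂ K] [FiniteDimensional ℂ K] [CompleteSpace K]

lemma inner_sum_inner_smul {ι : Type*} [Fintype ι] (b : OrthonormalBasis ι ℂ H) (x y : H) :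
    inner ℂ (∑ i, inner ℂ x (b i) • b i) (∑ i, inner ℂ y (b i) • b i) = inner ℂ y x := by
  rw [b.orthonormal.inner_sum, ← b.sum_inner_mul_inner y x]
  refine Finset.sum_congr rfl fun i _ => ?_
  rw [inner_conj_symm, mul_comm]

lemma sum_inner_sum_inner_smul {ι : Type*} [Fintype ι] (b : OrthonormalBasis ι ℂ H) (x : H) :
    ∑ i, inner ℂ (∑ j, inner ℂ x (b j) • b j) (b i) • b i = x := by
  conv_rhs => rw [← b.sum_repr' x]
  refine Finset.sum_congr rfl fun i _ => ?_
  rw [b.orthonormal.inner_left_fintype, inner_conj_symm]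

/-- The entrywise complex conjugation of vectors with respect to an orthonormal basis. -/
def basisConj {ι : Type*} [Fintype ι] (b : OrthonormalBasis ι ℂ H) : H ≃ₗᵢ⋆[ℂ] H where
  toFun x := ∑ i, inner ℂ x (b i) • b i
  invFun x := ∑ i, inner ℂ x (b i) • b i
  map_add' x y := by simp only [inner_add_left, add_smul, Finset.sum_add_distrib]
  map_smul' c x := by simp only [inner_smul_left, mul_smul, Finset.smul_sum]
  left_inv x := sum_inner_sum_inner_smul b x
  right_inv x := sum_inner_sum_inner_smul b x
  norm_map' x := by
    have h := inner_sum_inner_smul b x x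
    rw [inner_self_eq_norm_sq_to_K, inner_self_eq_norm_sq_to_K] at h
    exact (sq_eq_sq₀ (norm_nonneg _) (norm_nonneg _)).1 (by exact_mod_cast h)

lemma basisConj_apply {ι : Type*} [Fintype ι] (b : OrthonormalBasis ι ℂ H) (x : H) :
    basisConj b x = ∑ i, inner ℂ x (b i) • b i := rfl

@[simp] lemma basisConj_symm {ι : Type*} [Fintype ι] (b : OrthonormalBasis ι ℂ H) :
    (basisConj b).symm = basisConj b := rfl

lemma inner_antiunitary (j : H ≃ₗᵢ⋆[ℂ] K) (x y : H) : inner ℂ (j x) (j y) = inner ℂ y x := by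
  rw [inner_eq_sum_norm_sq_div_four, inner_eq_sum_norm_sq_div_four]
  have h1 : ‖j x + j y‖ = ‖y + x‖ := by rw [← map_add, j.norm_map, add_comm]
  have h2 : ‖j x - j y‖ = ‖y - x‖ := by rw [← map_sub, j.norm_map, norm_sub_rev]
  have h3 : ‖j x - Complex.I • j y‖ = ‖y - Complex.I • x‖ := by
    rw [show j x - Complex.I • j y = j (x + Complex.I • y) by
        rw [map_add, map_smulₛₗ, Complex.conj_I, neg_smul, sub_eq_add_neg],
      j.norm_map, show x + Complex.I • y = Complex.I • (y - Complex.I • x) by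
        rw [smul_sub, smul_smul, Complex.I_mul_I]; module, norm_smul]
    simp
  have h4 : ‖j x + Complex.I • j y‖ = ‖y + Complex.I • x‖ := by
    rw [show j x + Complex.I • j y = j (x - Complex.I • y) by
        rw [map_sub, map_smulₛₗ, Complex.conj_I, neg_smul, sub_neg_eq_add],
      j.norm_map, show x - Complex.I • y = -Complex.I • (y + Complex.I • x) by
        rw [smul_add, smul_smul, neg_mul, Complex.I_mul_I]; module, norm_smul]
    simp
  simp only [RCLike.I_to_complex]
  rw [h1, h2, h3, h4]

/-- The antiunitary transformation `X ↦ j X† j⁻¹` of operators given by an antiunitary `j`. -/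
def antiConj (j : H ≃ₗᵢ⋆[ℂ] K) : SuperOp H K where
  toFun X := ((j : H →SL[starRingEnd ℂ] K).comp (star X)).comp (j.symm : K →SL[starRingEnd ℂ] H)
  map_add' X Y := by ext; simp
  map_smul' c X := by ext; simp

@[simp] lemma antiConj_apply (j : H ≃ₗᵢ⋆[ℂ] K) (X : Operators H) (y : K) :
    antiConj j X y = j (star X (j.symm y)) := rfl

lemma inner_antiConj (j : H ≃ₗᵢ⋆[ℂ] K) (X : Operators H) (y z : K) :
    inner ℂ y (antiConj j X z) = inner ℂ (j.symm z) (X (j.symm y)) := by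
  rw [antiConj_apply]
  conv_lhs => rw [← j.apply_symm_apply y]
  rw [inner_antiunitary, star_eq_adjoint, adjoint_inner_left]

lemma antiConj_star (j : H ≃ₗᵢ⋆[ℂ] K) (X : Operators H) :
    antiConj j (star X) = star (antiConj j X) := by
  refine ContinuousLinearMap.ext fun z => ext_inner_left ℂ fun y => ?_
  rw [star_eq_adjoint (antiConj j X), adjoint_inner_right, ← inner_conj_symm _ z,
    inner_antiConj, inner_antiConj, star_eq_adjoint, adjoint_inner_right, inner_conj_symm]

lemma antiConj_mul (j : H ≃ₗᵢ⋆[ℂ] K) (X Y : Operators H) :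
    antiConj j (X * Y) = antiConj j Y * antiConj j X := by
  ext y
  simp only [antiConj_apply, star_mul, mul_apply_eq_comp]
  simp

lemma antiConj_rankOne (j : H ≃ₗᵢ⋆[ℂ] K) (x y : H) :
    antiConj j (rankOne ℂ x y) = rankOne ℂ (j y) (j x) := by
  ext z
  rw [antiConj_apply, star_eq_adjoint, adjoint_rankOne, rankOne_apply, rankOne_apply, map_smulₛₗ,
    inner_conj_symm, ← inner_antiunitary j, j.apply_symm_apply]

lemma antiConj_antiConj_symm (j : H ≃ₗᵢ⋆[ℂ] K) (X : Operators K) :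
    antiConj j (antiConj j.symm X) = X := by
  refine ContinuousLinearMap.ext fun z => ext_inner_left ℂ fun y => ?_
  rw [inner_antiConj, inner_antiConj]
  simp

/-- A unital order isomorphism between operator algebras is implemented by a unitary or by an
antiunitary (Kadison's theorem in finite dimension). -/
theorem IsOrderIso.exists_isometry {T : Operators H ≃ₗ[ℂ] Operators K} (hT : IsOrderIso T)
    (h1 : T 1 = 1) :
    ∃ σ : ℂ →+* ℂ, (σ = RingHom.id ℂ ∨ σ = starRingEnd ℂ) ∧ ∃ B : H →ₛₗ[σ] K,
      Function.Bijective B ∧ (∀ x, ‖B x‖ = ‖x‖) ∧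
      ∀ x, T (rankOne ℂ x x) = rankOne ℂ (B x) (B x) := by
  have hmulcase : ∀ F : Operators H →ₗ[ℂ] Operators K, Function.Bijective F →
      (∀ X Y, F (X * Y) = F X * F Y) → (∀ X, F (star X) = star (F X)) →
      ∃ U : H ≃ₗᵢ[ℂ] K, ∀ x, F (rankOne ℂ x x) = rankOne ℂ (U x) (U x) := by
    intro F hF hmul hstar
    obtain ⟨U, hU⟩ := StarAlgEquiv.eq_linearIsometryEquivConjStarAlgEquiv
      ({ LinearEquiv.ofBijective F hF with
          map_mul' := hmul, map_star' := hstar, map_smul' := F.map_smul } :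
        Operators H ≃⋆ₐ[ℂ] Operators K) (F.continuous_of_finiteDimensional)
    refine ⟨U, fun x => ?_⟩
    have h : F (rankOne ℂ x x) = U.conjStarAlgEquiv (rankOne ℂ x x) :=
      DFunLike.congr_fun hU (rankOne ℂ x x)
    rw [h]
    ext z
    simp only [LinearIsometryEquiv.conjStarAlgEquiv_apply_apply, rankOne_apply, map_smul]
    rw [← U.inner_map_map, U.apply_symm_apply]
  rcases mul_or_antimul_of_jordan T (hT.map_jordan h1) with h | h
  · obtain ⟨U, hU⟩ := hmulcase T.toLinearMap T.bijective h hT.map_star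
    exact ⟨RingHom.id ℂ, .inl rfl, U.toLinearEquiv.toLinearMap, U.bijective, U.norm_map, hU⟩
  · let c : H ≃ₗᵢ⋆[ℂ] H := basisConj (stdOrthonormalBasis ℂ H)
    have hc : ∀ X, antiConj c (antiConj c X) = X := antiConj_antiConj_symm c
    obtain ⟨U, hU⟩ := hmulcase (T.toLinearMap ∘ₗ antiConj c)
      (T.bijective.comp (Function.Involutive.bijective hc))
      (fun X Y => by
        simp only [LinearMap.comp_apply, antiConj_mul, LinearEquiv.coe_coe, h])
      (fun X => by simp only [LinearMap.comp_apply, antiConj_star, LinearEquiv.coe_coe,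
        hT.map_star])
    refine ⟨starRingEnd ℂ, .inr rfl, U.toLinearEquiv.toLinearMap.comp c.toLinearEquiv.toLinearMap,
      U.bijective.comp c.bijective, fun x => (U.norm_map _).trans (c.norm_map x), fun x => ?_⟩
    have := hU (c x)
    rw [LinearMap.comp_apply, antiConj_rankOne,
      show c (c x) = x from c.apply_symm_apply x] at this
    exact this

/-- An order isomorphism between operator algebras is implemented by an invertible linear or
antilinear map. It becomes unital after conjugation with the inverse square root of the image of
the identity. -/
theorem IsOrderIso.exists_semilinear {T : Operators H ≃ₗ[ℂ] Operators K} (hT : IsOrderIso T) :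
    ∃ σ : ℂ →+* ℂ, (σ = RingHom.id ℂ ∨ σ = starRingEnd ℂ) ∧ ∃ B : H →ₛₗ[σ] K,
      Function.Bijective B ∧ ∀ x, T (rankOne ℂ x x) = rankOne ℂ (B x) (B x) := by
  have hD0 : 0 ≤ T 1 := (hT 1).2 zero_le_one
  have hunit : IsUnit (T 1) := by
    set Y := T.symm 1
    have hY : IsSelfAdjoint Y := .of_nonneg ((hT.symm 1).2 zero_le_one)
    have hne : ((‖Y‖ + 1 : ℝ) : ℂ) ≠ 0 := by
      exact_mod_cast (by positivity : ‖Y‖ + 1 ≠ 0)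
    have hle : Y ≤ ((‖Y‖ + 1 : ℝ) : ℂ) • (1 : Operators H) := by
      refine (hY.le_algebraMap_norm_self).trans ?_
      rw [Algebra.algebraMap_eq_smul_one, ← sub_nonneg,
        show ((‖Y‖ + 1 : ℝ) : ℂ) • (1 : Operators H) = (‖Y‖ + 1) • (1 : Operators H) from rfl,
        ← sub_smul, add_sub_cancel_left, one_smul]
      exact zero_le_one
    have hle' : 1 ≤ ((‖Y‖ + 1 : ℝ) : ℂ) • T 1 := by
      have h := (hT.le_iff _ _).2 hle
      rwa [T.apply_symm_apply, map_smul] at h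
    have hu : IsUnit (((‖Y‖ + 1 : ℝ) : ℂ) • T 1) :=
      CStarAlgebra.isUnit_of_le 1 hle' isStrictlyPositive_one
    exact (isUnit_smul_iff (Units.mk0 _ hne) (T 1)).1 hu
  set R := CFC.sqrt (T 1)
  have hR : IsUnit R := (CFC.isUnit_sqrt_iff _ hD0).2 hunit
  have hRR : R * R = T 1 := CFC.sqrt_mul_sqrt_self _ hD0
  have hRsa : star R = R := (IsSelfAdjoint.of_nonneg (CFC.sqrt_nonneg _)).star_eq
  obtain ⟨u, hu⟩ := hR
  have hsu : star (u⁻¹ : (Operators K)ˣ) = u⁻¹ := by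
    rw [star_inv, show star u = u from Units.ext (by rw [Units.coe_star, hu, hRsa])]
  let C : Operators K ≃ₗ[ℂ] Operators K :=
    { toFun := fun X => u⁻¹ * X * u⁻¹
      invFun := fun X => u * X * u
      map_add' := fun X Y => by rw [mul_add, add_mul]
      map_smul' := fun c X => by simp
      left_inv := fun X => by simp [mul_assoc]
      right_inv := fun X => by simp [mul_assoc] }
  have hC : IsOrderIso (T.trans C) := fun X => by
    rw [← hT X]
    have h := (u⁻¹).isUnit.star_left_conjugate_nonneg_iff (x := T X)
    rwa [← Units.coe_star, hsu] at h
  obtain ⟨σ, hσ, B, hB, -, hTB⟩ := hC.exists_isometry (by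
    change (u⁻¹ : (Operators K)ˣ).1 * T 1 * (u⁻¹ : (Operators K)ˣ).1 = 1
    rw [← hRR, ← hu]
    simp)
  refine ⟨σ, hσ, R.toLinearMap.comp B, ?_, fun x => ?_⟩
  · have hRb : Function.Bijective R := by
      rw [← hu]
      exact isUnit_iff_bijective.1 u.isUnit
    exact hRb.comp hB
  · have h : T (rankOne ℂ x x) = u * (T.trans C (rankOne ℂ x x)) * u :=
      (C.symm_apply_apply (T (rankOne ℂ x x))).symm
    rw [h, hTB, hu]
    nth_rw 2 [← hRsa]
    rw [mul_def, mul_def, comp_rankOne, rankOne_comp, star_eq_adjoint, adjoint_adjoint]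
    rfl

end Core

/-! ### Linear extension of affine maps on part of a cone -/

section Extension

variable {A W : Type*} [CStarAlgebra A] [PartialOrder A] [StarOrderedRing A]
  [AddCommGroup W] [Module ℂ W]

/-- An additive and positively homogeneous map on the positive cone of a C⋆-algebra extends to a
complex-linear map. -/
lemma exists_linear_extension_of_cone (g : A → W)
    (hadd : ∀ X Y, 0 ≤ X → 0 ≤ Y → g (X + Y) = g X + g Y)
    (hsmul : ∀ (r : ℝ) X, 0 ≤ r → 0 ≤ X → g ((r : ℂ) • X) = (r : ℂ) • g X) :
    ∃ T : A →ₗ[ℂ] W, ∀ X, 0 ≤ X → T X = g X := by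
  let h : selfAdjoint A → W := fun x => g ((x : A)⁺) - g ((x : A)⁻)
  have hwd : ∀ (x : selfAdjoint A) (P N : A), 0 ≤ P → 0 ≤ N → (x : A) = P - N →
      h x = g P - g N := by
    intro x P N hP hN hx
    have h1 : (x : A)⁺ + N = P + (x : A)⁻ := by
      have h2 := CFC.posPart_sub_negPart (x : A) x.2
      rw [hx] at h2 ⊢
      rw [← sub_eq_sub_iff_add_eq_add, h2]
    have h3 := congrArg g h1
    rw [hadd _ _ (CFC.posPart_nonneg _) hN, hadd _ _ hP (CFC.negPart_nonneg _)] at h3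
    exact sub_eq_sub_iff_add_eq_add.2 h3
  have hpn : ∀ x : selfAdjoint A, (x : A) = (x : A)⁺ - (x : A)⁻ := fun x =>
    (CFC.posPart_sub_negPart (x : A) x.2).symm
  have hg0 : g 0 = 0 := by simpa using hsmul 0 0 le_rfl le_rfl
  have h_add : ∀ x y, h (x + y) = h x + h y := by
    intro x y
    rw [hwd (x + y) ((x : A)⁺ + (y : A)⁺) ((x : A)⁻ + (y : A)⁻)
      (add_nonneg (CFC.posPart_nonneg _) (CFC.posPart_nonneg _))
      (add_nonneg (CFC.negPart_nonneg _) (CFC.negPart_nonneg _))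
      (by rw [AddSubgroup.coe_add]; nth_rw 1 [hpn x, hpn y]; abel),
      hadd _ _ (CFC.posPart_nonneg _) (CFC.posPart_nonneg _),
      hadd _ _ (CFC.negPart_nonneg _) (CFC.negPart_nonneg _)]
    simp only [h]
    abel
  have hnn : ∀ (r : ℝ) (P : A), 0 ≤ r → 0 ≤ P → 0 ≤ (r : ℂ) • P := fun r P hr hP =>
    (smul_nonneg hr hP : 0 ≤ r • P)
  have h_smul : ∀ (r : ℝ) x, h (r • x) = (r : ℂ) • h x := by
    intro r x
    have hcoe : ((r • x : selfAdjoint A) : A) = (r : ℂ) • (x : A)⁺ - (r : ℂ) • (x : A)⁻ := by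
      rw [← smul_sub, ← hpn x]; rfl
    rcases le_total 0 r with hr | hr
    · rw [hwd (r • x) _ _ (hnn r _ hr (CFC.posPart_nonneg _)) (hnn r _ hr (CFC.negPart_nonneg _))
        hcoe, hsmul _ _ hr (CFC.posPart_nonneg _), hsmul _ _ hr (CFC.negPart_nonneg _), smul_sub]
    · have hr' : 0 ≤ -r := neg_nonneg.2 hr
      rw [hwd (r • x) _ _ (hnn (-r) _ hr' (CFC.negPart_nonneg (x : A)))
        (hnn (-r) _ hr' (CFC.posPart_nonneg (x : A)))
        (by rw [hcoe]; push_cast; module), hsmul _ _ hr' (CFC.negPart_nonneg _),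
        hsmul _ _ hr' (CFC.posPart_nonneg _)]
      push_cast
      simp only [h]
      module
  let T : A →ₗ[ℂ] W :=
    { toFun := fun X => h (ℜ X) + Complex.I • h (ℑ X)
      map_add' := fun X Y => by simp only [map_add, h_add, smul_add]; abel
      map_smul' := fun z X => by
        have hsub : ∀ x y, h (x - y) = h x - h y := fun x y => by
          have := h_smul (-1) y
          rw [sub_eq_add_neg, h_add, ← neg_one_smul ℝ y, this]; push_cast; module
        simp only [realPart_smul, imaginaryPart_smul, hsub, h_add, h_smul, RingHom.id_apply]
        generalize h (ℜ X) = a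
        generalize h (ℑ X) = b
        have hI : Complex.I • Complex.I • b = -b := by
          rw [smul_smul, Complex.I_mul_I, neg_one_smul]
        conv_rhs => rw [← Complex.re_add_im z]
        linear_combination (norm := module) (-z.im : ℂ) • hI }
  refine ⟨T, fun X hX => ?_⟩
  have hXsa : IsSelfAdjoint X := .of_nonneg hX
  change h (ℜ X) + Complex.I • h (ℑ X) = g X
  rw [imaginaryPart_eq_zero_iff.2 hXsa, hwd (ℜ X) X 0 hX le_rfl
    (by rw [hXsa.coe_realPart, sub_zero]), hwd 0 0 0 le_rfl le_rfl (by simp), hg0]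
  simp

/-- An affine map that fixes zero, on a convex absorbing part of the positive cone of a
C⋆-algebra, extends to a complex-linear map. -/
lemma exists_linear_extension_of_affine (O : Set A) (S : A → W) (h0 : 0 ∈ O)
    (hconv : ∀ X ∈ O, ∀ Y ∈ O, ∀ p : ℝ, 0 ≤ p → p ≤ 1 →
      (p : ℂ) • X + ((1 - p : ℝ) : ℂ) • Y ∈ O)
    (habs : ∀ X, 0 ≤ X → ∃ r : ℝ, 0 < r ∧ (r : ℂ) • X ∈ O)
    (hS0 : S 0 = 0)
    (hS : ∀ X ∈ O, ∀ Y ∈ O, ∀ p : ℝ, 0 ≤ p → p ≤ 1 →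
      S ((p : ℂ) • X + ((1 - p : ℝ) : ℂ) • Y) = (p : ℂ) • S X + ((1 - p : ℝ) : ℂ) • S Y)
    (hO : ∀ X ∈ O, 0 ≤ X) :
    ∃ T : A →ₗ[ℂ] W, ∀ X ∈ O, T X = S X := by
  have hdown : ∀ X ∈ O, ∀ p : ℝ, 0 ≤ p → p ≤ 1 → (p : ℂ) • X ∈ O := fun X hX p hp hp1 => by
    simpa using hconv X hX 0 h0 p hp hp1
  have hSdown : ∀ X ∈ O, ∀ p : ℝ, 0 ≤ p → p ≤ 1 → S ((p : ℂ) • X) = (p : ℂ) • S X :=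
    fun X hX p hp hp1 => by simpa [hS0] using hS X hX 0 h0 p hp hp1
  choose! r hr0 hr using habs
  have hshrink : ∀ X (s t : ℝ), 0 < s → s ≤ t → (t : ℂ) • X ∈ O → (s : ℂ) • X ∈ O ∧
      ((s⁻¹ : ℝ) : ℂ) • S ((s : ℂ) • X) = ((t⁻¹ : ℝ) : ℂ) • S ((t : ℂ) • X) := by
    intro X s t hs hst ht
    have ht0 : 0 < t := hs.trans_le hst
    have he : (s : ℂ) • X = ((s / t : ℝ) : ℂ) • (t : ℂ) • X := by
      rw [smul_smul, ← Complex.ofReal_mul, div_mul_cancel₀ _ ht0.ne']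
    have h1 : s / t ≤ 1 := (div_le_one ht0).2 hst
    have h2 : 0 ≤ s / t := by positivity
    rw [he]
    refine ⟨hdown _ ht _ h2 h1, ?_⟩
    rw [hSdown _ ht _ h2 h1, smul_smul, ← Complex.ofReal_mul]
    congr 3
    field_simp
  let g : A → W := fun X => (((r X)⁻¹ : ℝ) : ℂ) • S ((r X : ℂ) • X)
  have hg : ∀ X, 0 ≤ X → ∀ t : ℝ, 0 < t → (t : ℂ) • X ∈ O →
      g X = ((t⁻¹ : ℝ) : ℂ) • S ((t : ℂ) • X) := by
    intro X hX t ht htX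
    rcases le_total t (r X) with h | h
    · exact (hshrink X t (r X) ht h (hr X hX)).2.symm
    · exact (hshrink X (r X) t (hr0 X hX) h htX).2
  obtain ⟨T, hT⟩ := exists_linear_extension_of_cone g (by
    intro X Y hX hY
    obtain ⟨t, ht, htX, htY⟩ : ∃ t : ℝ, 0 < t ∧ (t : ℂ) • X ∈ O ∧ (t : ℂ) • Y ∈ O :=
      ⟨min (r X) (r Y), lt_min (hr0 X hX) (hr0 Y hY),
        (hshrink X _ _ (lt_min (hr0 X hX) (hr0 Y hY)) (min_le_left _ _) (hr X hX)).1,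
        (hshrink Y _ _ (lt_min (hr0 X hX) (hr0 Y hY)) (min_le_right _ _) (hr Y hY)).1⟩
    have he : ((t / 2 : ℝ) : ℂ) • (X + Y) =
        ((1 / 2 : ℝ) : ℂ) • (t : ℂ) • X + ((1 - 1 / 2 : ℝ) : ℂ) • (t : ℂ) • Y := by
      push_cast; module
    have hmem := hconv _ htX _ htY (1 / 2) (by norm_num) (by norm_num)
    rw [hg (X + Y) (add_nonneg hX hY) (t / 2) (by positivity) (he ▸ hmem), he,
      hS _ htX _ htY _ (by norm_num) (by norm_num), hg X hX t ht htX, hg Y hY t ht htY, smul_add,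
      smul_smul, smul_smul, ← Complex.ofReal_mul, ← Complex.ofReal_mul]
    congr 4; field_simp; norm_num)
    (by
    intro c X hc hX
    rcases hc.eq_or_lt with rfl | hc
    · simp [g, hS0]
    have hcX : 0 ≤ (c : ℂ) • X := (smul_nonneg hc.le hX : 0 ≤ c • X)
    have hmem := hr _ hcX
    have hr' := hr0 _ hcX
    rw [hg _ hcX _ hr' hmem]
    rw [smul_smul, ← Complex.ofReal_mul] at hmem ⊢
    rw [hg X hX _ (mul_pos hr' hc) hmem, smul_smul, ← Complex.ofReal_mul]
    congr 3
    field_simp)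
  refine ⟨T, fun X hX => ?_⟩
  rw [hT X (hO X hX), hg X (hO X hX) 1 one_pos (by simpa using hX)]
  simp

end Extension

/-! ### The Choi isomorphism -/

section Choi

variable {H K : Type*}
    [NormedAddCommGroup H] [InnerProductSpace ℂ H] [FiniteDimensional ℂ H] [CompleteSpace H]
    [NormedAddCommGroup K] [InnerProductSpace ℂ K] [FiniteDimensional ℂ K] [CompleteSpace K]

variable (H K) in
/-- The Hilbert space on which the Choi operator of a map `L(H) → L(K)` acts: the tensor product
of `H` and `K`, realised as a direct sum of copies of `K`. -/
abbrev ChoiSpace : Type _ := PiLp 2 (fun _ : Fin (Module.finrank ℂ H) => K)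

/-- The inclusion of the `i`-th copy of `K`. -/
def choiIncl (i : Fin (Module.finrank ℂ H)) : K →L[ℂ] ChoiSpace H K :=
  LinearMap.toContinuousLinearMap
    { toFun := fun y => PiLp.single 2 i y
      map_add' := fun x y => by ext; simp [PiLp.single_apply]; split_ifs <;> simp
      map_smul' := fun c y => by ext; simp [PiLp.single_apply] }

/-- The projection onto the `i`-th copy of `K`. -/
def choiProj (i : Fin (Module.finrank ℂ H)) : ChoiSpace H K →L[ℂ] K :=
  PiLp.proj 2 (fun _ : Fin (Module.finrank ℂ H) => K) i

lemma choiProj_apply (i : Fin (Module.finrank ℂ H)) (v : ChoiSpace H K) : choiProj i v = v i := rfl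

lemma choiProj_choiIncl (i j : Fin (Module.finrank ℂ H)) (y : K) :
    choiProj j (choiIncl i y : ChoiSpace H K) = if j = i then y else 0 := by
  change (PiLp.single 2 i y : ChoiSpace H K) j = _
  rw [PiLp.single_apply]

lemma sum_choiIncl_choiProj (v : ChoiSpace H K) : ∑ i, choiIncl i (choiProj i v) = v := by
  ext j
  change choiProj j (∑ i, choiIncl i (choiProj i v)) = v j
  rw [map_sum]
  simp only [choiProj_choiIncl]
  simp [choiProj_apply]

lemma adjoint_choiProj (i : Fin (Module.finrank ℂ H)) :
    adjoint (choiProj i : ChoiSpace H K →L[ℂ] K) = choiIncl i := by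
  symm
  rw [eq_adjoint_iff]
  intro x y
  rw [PiLp.inner_apply]
  simp only [← choiProj_apply, choiProj_choiIncl]
  rw [Finset.sum_eq_single i]
  · simp
  · intro j _ hj; simp [hj]
  · simp

/-- The Kraus operator `V : H → K` as a vector of the Choi space. -/
def choiVec : (H →L[ℂ] K) ≃ₗ[ℂ] ChoiSpace H K where
  toFun V := WithLp.toLp 2 fun i => V (stdOrthonormalBasis ℂ H i)
  map_add' V W := by ext; simp
  map_smul' c V := by ext; simp
  invFun v := ∑ i, rankOne ℂ (v i) (stdOrthonormalBasis ℂ H i)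
  left_inv V := by
    ext x
    conv_rhs => rw [← (stdOrthonormalBasis ℂ H).sum_repr' x]
    simp [_root_.sum_apply]
  right_inv v := by
    ext j
    simp [_root_.sum_apply, orthonormal_iff_ite.1 (stdOrthonormalBasis ℂ H).orthonormal]

lemma sum_inner_smul_rankOne (X : Operators H) :
    ∑ i, ∑ j, inner ℂ (stdOrthonormalBasis ℂ H i) (X (stdOrthonormalBasis ℂ H j)) •
      rankOne ℂ (stdOrthonormalBasis ℂ H i) (stdOrthonormalBasis ℂ H j) = X := by
  ext x
  conv_rhs => rw [← (stdOrthonormalBasis ℂ H).sum_repr' x]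
  rw [Finset.sum_comm]
  simp only [_root_.sum_apply, map_sum, map_smul]
  refine Finset.sum_congr rfl fun j _ => ?_
  conv_rhs => rw [← (stdOrthonormalBasis ℂ H).sum_repr' (X (stdOrthonormalBasis ℂ H j))]
  rw [Finset.smul_sum]
  refine Finset.sum_congr rfl fun i _ => ?_
  rw [_root_.smul_apply, rankOne_apply, smul_comm]

/-- The Choi isomorphism, which sends a map `Q` to the block operator with the blocks
`Q(|eᵢ⟩⟨eⱼ|)`. -/
def choi : SuperOp H K ≃ₗ[ℂ] Operators (ChoiSpace H K) where
  toFun Q := ∑ i, ∑ j, choiIncl i ∘L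
    Q (rankOne ℂ (stdOrthonormalBasis ℂ H i) (stdOrthonormalBasis ℂ H j)) ∘L choiProj j
  map_add' Q R := by
    simp only [LinearMap.add_apply, ContinuousLinearMap.add_comp, ContinuousLinearMap.comp_add,
      Finset.sum_add_distrib]
  map_smul' c Q := by
    simp only [LinearMap.smul_apply, ContinuousLinearMap.smul_comp, ContinuousLinearMap.comp_smul,
      Finset.smul_sum, RingHom.id_apply]
  invFun X :=
    { toFun := fun ρ => ∑ i, ∑ j,
        inner ℂ (stdOrthonormalBasis ℂ H i) (ρ (stdOrthonormalBasis ℂ H j)) •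
          (choiProj i ∘L X ∘L choiIncl j)
      map_add' := fun ρ σ => by
        simp only [_root_.add_apply, inner_add_right, add_smul, Finset.sum_add_distrib]
      map_smul' := fun c ρ => by
        simp only [_root_.smul_apply, inner_smul_right, mul_smul, Finset.smul_sum,
          RingHom.id_apply] }
  left_inv Q := by
    ext1 ρ
    conv_rhs => rw [← sum_inner_smul_rankOne ρ]
    simp only [map_sum, map_smul, LinearMap.coe_mk, AddHom.coe_mk]
    refine Finset.sum_congr rfl fun i _ => ?_
    refine Finset.sum_congr rfl fun j _ => ?_
    congr 1
    ext y
    simp [_root_.sum_apply, choiProj_choiIncl, apply_ite]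
  right_inv X := by
    have h : ∀ i j, ∑ i', ∑ j', inner ℂ (stdOrthonormalBasis ℂ H i')
        (rankOne ℂ (stdOrthonormalBasis ℂ H i) (stdOrthonormalBasis ℂ H j)
          (stdOrthonormalBasis ℂ H j')) • (choiProj i' ∘L X ∘L choiIncl j') =
        choiProj i ∘L X ∘L choiIncl j := by
      intro i j
      simp only [inner_right_rankOne_apply,
        orthonormal_iff_ite.1 (stdOrthonormalBasis ℂ H).orthonormal]
      simp [ite_smul]
    ext1 v
    simp only [LinearMap.coe_mk, AddHom.coe_mk, h]
    simp only [_root_.sum_apply, ContinuousLinearMap.comp_apply]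
    simp only [← map_sum, sum_choiIncl_choiProj]

/-- The map `X ↦ V X W†`. -/
def krausMap (V W : H →L[ℂ] K) : SuperOp H K where
  toFun X := V ∘L X ∘L adjoint W
  map_add' X Y := by rw [ContinuousLinearMap.add_comp, ContinuousLinearMap.comp_add]
  map_smul' c X := by
    rw [ContinuousLinearMap.smul_comp, ContinuousLinearMap.comp_smul, RingHom.id_apply]

lemma krausMap_apply (V W : H →L[ℂ] K) (X : Operators H) :
    krausMap V W X = V ∘L X ∘L adjoint W := rfl

lemma choi_apply (Q : SuperOp H K) : choi Q = ∑ i, ∑ j, choiIncl i ∘L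
    Q (rankOne ℂ (stdOrthonormalBasis ℂ H i) (stdOrthonormalBasis ℂ H j)) ∘L choiProj j := rfl

lemma choi_krausMap (V W : H →L[ℂ] K) :
    choi (krausMap V W) = rankOne ℂ (choiVec V) (choiVec W) := by
  have h : ∀ V : H →L[ℂ] K, ∑ i, choiIncl i (V (stdOrthonormalBasis ℂ H i)) = choiVec V :=
    fun V => sum_choiIncl_choiProj (choiVec V)
  rw [choi_apply, ← h V, ← h W]
  simp only [map_sum, _root_.sum_apply, krausMap_apply]
  rw [Finset.sum_comm]
  refine Finset.sum_congr rfl fun i _ => Finset.sum_congr rfl fun j _ => ?_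
  rw [rankOne_comp, comp_rankOne, rankOne_comp, comp_rankOne, adjoint_choiProj, adjoint_adjoint]

/-- Positive Choi operators are those of maps with a Kraus decomposition. -/
lemma exists_kraus {Q : SuperOp H K} (hQ : 0 ≤ choi Q) :
    ∃ (n : ℕ) (V : Fin n → H →L[ℂ] K), Q = ∑ i, krausMap (V i) (V i) := by
  obtain ⟨n, u, hu⟩ := isPositive_iff_eq_sum_rankOne.1 ((nonneg_iff_isPositive _).1 hQ)
  refine ⟨n, fun i => choiVec.symm (u i), choi.injective ?_⟩
  simp only [map_sum, choi_krausMap, LinearEquiv.apply_symm_apply, hu]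

lemma choi_krausMap_nonneg (V : H →L[ℂ] K) : 0 ≤ choi (krausMap V V) := by
  rw [choi_krausMap]
  exact rankOne_self_nonneg _

lemma cstarMatrix_nonneg_induction {n : ℕ} {p : CStarMatrix (Fin n) (Fin n) (Operators H) → Prop}
    (h0 : p 0) (hadd : ∀ M N, p M → p N → p (M + N)) (hstar : ∀ N, p (star N * N))
    {M : CStarMatrix (Fin n) (Fin n) (Operators H)} (hM : 0 ≤ M) : p M := by
  rw [StarOrderedRing.nonneg_iff] at hM
  induction hM using AddSubmonoid.closure_induction with
  | mem x hx => obtain ⟨N, rfl⟩ := hx; exact hstar N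
  | zero => exact h0
  | add x y _ _ hx hy => exact hadd x y hx hy

lemma cstarMatrix_map_add_map {n : ℕ} (M : CStarMatrix (Fin n) (Fin n) (Operators H))
    (Q R : SuperOp H K) : M.map ⇑(Q + R) = M.map Q + M.map R := rfl

/-- The map `X ↦ V X V†` is completely positive. -/
lemma krausMap_cstarMatrix_nonneg (V : H →L[ℂ] K) (k : ℕ)
    (M : CStarMatrix (Fin k) (Fin k) (Operators H)) (hM : 0 ≤ M) :
    0 ≤ M.map (krausMap V V) := by
  rcases subsingleton_or_nontrivial K with hK | hK
  · have : M.map (krausMap V V) = 0 := by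
      ext i j : 1
      exact Subsingleton.elim _ _
    rw [this]
  obtain ⟨b, hb⟩ := exists_norm_eq K zero_le_one
  let e := stdOrthonormalBasis ℂ H
  refine cstarMatrix_nonneg_induction (p := fun M => 0 ≤ M.map (krausMap V V)) ?_ ?_ ?_ hM
  · rw [show (0 : CStarMatrix (Fin k) (Fin k) (Operators H)).map (krausMap V V) = 0 by
      ext i j : 1; exact (krausMap V V).map_zero]
  · intro M N hM hN
    rw [show (M + N).map (krausMap V V) = M.map (krausMap V V) + N.map (krausMap V V) by
      ext i j : 1; exact (krausMap V V).map_add (M i j) (N i j)]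
    exact add_nonneg hM hN
  · intro N
    change 0 ≤ (star N * N).map (krausMap V V)
    -- the identity of `H` is split as `∑ |eₗ⟩⟨eₗ| = ∑ (|b⟩⟨eₗ|)† |b⟩⟨eₗ|`, so that all factors
    -- act on `K`
    let N' : Fin (Module.finrank ℂ H) → CStarMatrix (Fin k) (Fin k) (Operators K) :=
      fun l => CStarMatrix.ofMatrix fun i j => rankOne ℂ b (e l) ∘L N i j ∘L adjoint V
    have hsum : (star N * N).map (krausMap V V) = ∑ l, star (N' l) * N' l := by
      have hl : ∀ i j, (∑ l, star (N' l) * N' l) i j = ∑ l, (star (N' l) * N' l) i j :=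
        fun i j => Matrix.sum_apply i j _ _
      have hterm : ∀ m l i j, star (N' l m i) * N' l m j =
          V ∘L adjoint (N m i) ∘L rankOne ℂ (e l) (e l) ∘L N m j ∘L adjoint V := by
        intro m l i j
        change adjoint (rankOne ℂ b (e l) ∘L N m i ∘L adjoint V) ∘L
          (rankOne ℂ b (e l) ∘L N m j ∘L adjoint V) = _
        rw [adjoint_comp, adjoint_comp, adjoint_adjoint, adjoint_rankOne]
        ext y
        simp [inner_self_eq_norm_sq_to_K, hb]
      ext i j : 1
      rw [hl]
      simp only [CStarMatrix.mul_apply, CStarMatrix.star_apply, CStarMatrix.map_apply]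
      rw [Finset.sum_comm, map_sum]
      refine Finset.sum_congr rfl fun m _ => ?_
      simp only [hterm]
      ext y
      simp only [_root_.sum_apply, ContinuousLinearMap.comp_apply, krausMap_apply, ← map_sum]
      congr 1
      rw [mul_apply_eq_comp, star_eq_adjoint]
      congr 1
      simp only [rankOne_apply]
      exact (e.sum_repr' _).symm
    rw [hsum]
    exact Finset.sum_nonneg fun l _ => star_mul_self_nonneg (N' l)

/-- A positive block matrix is positive as an operator on the direct sum. -/
lemma sum_incl_comp_proj_nonneg
    (P : CStarMatrix (Fin (Module.finrank ℂ H)) (Fin (Module.finrank ℂ H)) (Operators K))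
    (hP : 0 ≤ P) :
    0 ≤ ∑ i, ∑ j, (choiIncl i : K →L[ℂ] ChoiSpace H K) ∘L P i j ∘L choiProj j := by
  refine cstarMatrix_nonneg_induction (p := fun P =>
    0 ≤ ∑ i, ∑ j, (choiIncl i : K →L[ℂ] ChoiSpace H K) ∘L P i j ∘L choiProj j) ?_ ?_ ?_ hP
  · simp
  · intro M N hM hN
    simp only [CStarMatrix.add_apply, ContinuousLinearMap.add_comp, ContinuousLinearMap.comp_add,
      Finset.sum_add_distrib]
    exact add_nonneg hM hN
  · intro N
    let R : Fin (Module.finrank ℂ H) → ChoiSpace H K →L[ℂ] K := fun k => ∑ j, N k j ∘L choiProj j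
    have hR : ∑ i, ∑ j, (choiIncl i : K →L[ℂ] ChoiSpace H K) ∘L (star N * N) i j ∘L choiProj j =
        ∑ k, adjoint (R k) ∘L R k := by
      ext1 v
      simp only [_root_.sum_apply, ContinuousLinearMap.comp_apply, CStarMatrix.mul_apply,
        CStarMatrix.star_apply, R, map_sum, adjoint_comp, adjoint_choiProj, star_eq_adjoint,
        mul_apply_eq_comp]
      rw [Finset.sum_comm_cycle]
      refine Finset.sum_congr rfl fun k _ => ?_
      rw [Finset.sum_comm]
    rw [hR]
    exact Finset.sum_nonneg fun k _ =>
      (nonneg_iff_isPositive _).2 (isPositive_adjoint_comp_self (R k))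

/-- Choi's theorem: a map is completely positive iff its Choi operator is positive. -/
lemma completelyPositive_iff (Q : SuperOp H K) :
    (∃ Φ : Operators H →CP Operators K, Φ.toLinearMap = Q) ↔ 0 ≤ choi Q := by
  constructor
  · rintro ⟨Φ, rfl⟩
    set n := Module.finrank ℂ H
    let e := stdOrthonormalBasis ℂ H
    let M : CStarMatrix (Fin n) (Fin n) (Operators H) :=
      CStarMatrix.ofMatrix fun i j => rankOne ℂ (e i) (e j)
    have hM : 0 ≤ M := by
      rcases isEmpty_or_nonempty (Fin n) with h | ⟨⟨i₀⟩⟩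
      · rw [show M = 0 by ext i; exact h.elim i]
      · let N : CStarMatrix (Fin n) (Fin n) (Operators H) :=
          CStarMatrix.ofMatrix fun k i => if k = i₀ then rankOne ℂ (e i₀) (e i) else 0
        have : M = star N * N := by
          have hN : ∀ k i, N k i = if k = i₀ then rankOne ℂ (e i₀) (e i) else 0 := fun _ _ => rfl
          ext i j : 1
          rw [CStarMatrix.mul_apply, Finset.sum_eq_single i₀]
          · rw [CStarMatrix.star_apply, hN, hN, if_pos rfl, if_pos rfl, star_eq_adjoint,
              adjoint_rankOne, mul_def, rankOne_comp_rankOne, inner_self_eq_norm_sq_to_K,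
              e.norm_eq_one]
            simp only [map_one, one_pow, one_smul]
            rfl
          · intro k _ hk
            rw [hN k j, if_neg hk, mul_zero]
          · simp
        rw [this]
        exact star_mul_self_nonneg N
    exact sum_incl_comp_proj_nonneg _ (Φ.map_cstarMatrix_nonneg' n M hM)
  · intro h
    obtain ⟨n, V, hV⟩ := exists_kraus h
    refine ⟨⟨Q, fun k M hM => ?_⟩, rfl⟩
    have : ∀ s : Finset (Fin n),
        0 ≤ M.map (∑ i ∈ s, krausMap (V i) (V i) : SuperOp H K) := by
      intro s
      induction s using Finset.cons_induction with
      | empty =>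
        rw [Finset.sum_empty]
        exact le_of_eq rfl
      | cons a s ha ih =>
        rw [Finset.sum_cons, cstarMatrix_map_add_map]
        exact add_nonneg (krausMap_cstarMatrix_nonneg (V a) k M hM) ih
    rw [hV]
    exact this _

end Choi

/-! ### Effects of quantum operations -/

section Effect

variable {H K : Type*}
    [NormedAddCommGroup H] [InnerProductSpace ℂ H] [FiniteDimensional ℂ H] [CompleteSpace H]
    [NormedAddCommGroup K] [InnerProductSpace ℂ K] [FiniteDimensional ℂ K] [CompleteSpace K]

lemma tr_add (X Y : Operators H) : tr (X + Y) = tr X + tr Y := by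
  simp [tr]

lemma tr_smul (c : ℂ) (X : Operators H) : tr (c • X) = c * tr X := by
  simp [tr]

lemma tr_sum {ι : Type*} (s : Finset ι) (X : ι → Operators H) :
    tr (∑ i ∈ s, X i) = ∑ i ∈ s, tr (X i) := by
  induction s using Finset.cons_induction with
  | empty => simp [tr]
  | cons a s ha ih => rw [Finset.sum_cons, Finset.sum_cons, tr_add, ih]

lemma tr_rankOne (x y : H) : tr (rankOne ℂ x y) = inner ℂ y x := trace_rankOne x y

lemma ofReal_smul_nonneg {r : ℝ} (hr : 0 ≤ r) {X : Operators H} (hX : 0 ≤ X) :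
    0 ≤ (r : ℂ) • X :=
  (smul_nonneg hr hX : 0 ≤ r • X)

/-- The effect of a quantum operation `Q`: the operator `E` with `Tr Q(ρ) = Tr E ρ` for all `ρ`. -/
def effect : SuperOp H K →ₗ[ℂ] Operators H where
  toFun Q := ∑ i, ∑ j, tr (Q (rankOne ℂ (stdOrthonormalBasis ℂ H j) (stdOrthonormalBasis ℂ H i))) •
    rankOne ℂ (stdOrthonormalBasis ℂ H i) (stdOrthonormalBasis ℂ H j)
  map_add' Q R := by
    simp only [LinearMap.add_apply, tr_add, add_smul, Finset.sum_add_distrib]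
  map_smul' c Q := by
    simp only [LinearMap.smul_apply, tr_smul, mul_smul, Finset.smul_sum, RingHom.id_apply]

lemma effect_apply (Q : SuperOp H K) : effect Q =
    ∑ i, ∑ j, tr (Q (rankOne ℂ (stdOrthonormalBasis ℂ H j) (stdOrthonormalBasis ℂ H i))) •
      rankOne ℂ (stdOrthonormalBasis ℂ H i) (stdOrthonormalBasis ℂ H j) := rfl

lemma krausMap_rankOne (V W : H →L[ℂ] K) (x y : H) :
    krausMap V W (rankOne ℂ x y) = rankOne ℂ (V x) (W y) := by
  rw [krausMap_apply, rankOne_comp, comp_rankOne, adjoint_adjoint]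

lemma effect_krausMap (V W : H →L[ℂ] K) : effect (krausMap V W) = adjoint W ∘L V := by
  rw [effect_apply, ← sum_inner_smul_rankOne (adjoint W ∘L V)]
  refine Finset.sum_congr rfl fun i _ => Finset.sum_congr rfl fun j _ => ?_
  rw [krausMap_rankOne, tr_rankOne, ContinuousLinearMap.comp_apply, adjoint_inner_right]

lemma effect_nonneg {Q : SuperOp H K} (hQ : 0 ≤ choi Q) : 0 ≤ effect Q := by
  obtain ⟨n, V, rfl⟩ := exists_kraus hQ
  rw [map_sum]
  refine Finset.sum_nonneg fun i _ => ?_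
  rw [effect_krausMap]
  exact (nonneg_iff_isPositive _).2 (isPositive_adjoint_comp_self _)

lemma tr_apply_rankOne {Q : SuperOp H K} (hQ : 0 ≤ choi Q) (x : H) :
    tr (Q (rankOne ℂ x x)) = inner ℂ (effect Q x) x := by
  obtain ⟨n, V, rfl⟩ := exists_kraus hQ
  simp only [map_sum, LinearMap.sum_apply, _root_.sum_apply, sum_inner, tr_sum]
  refine Finset.sum_congr rfl fun i _ => ?_
  rw [krausMap_rankOne, tr_rankOne, effect_krausMap, ContinuousLinearMap.comp_apply,
    adjoint_inner_left]

/-- Quantum operations are the completely positive maps whose effect is at most the identity. -/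
lemma mem_operations_iff (Q : SuperOp H K) :
    Q ∈ operations H K ↔ 0 ≤ choi Q ∧ effect Q ≤ 1 := by
  rw [← completelyPositive_iff]
  refine and_congr_right fun hQ => ?_
  have hC := (completelyPositive_iff Q).1 hQ
  constructor
  · intro h
    rw [le_def, isPositive_def']
    refine ⟨(IsSelfAdjoint.one _).sub (.of_nonneg (effect_nonneg hC)), fun x => ?_⟩
    have hx := h _ (rankOne_self_nonneg x)
    rw [tr_apply_rankOne hC, tr_rankOne] at hx
    rw [reApplyInnerSelf, _root_.sub_apply, inner_sub_left, map_sub, sub_nonneg]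
    exact hx
  · intro h ρ hρ
    obtain ⟨n, u, rfl⟩ := isPositive_iff_eq_sum_rankOne.1 ((nonneg_iff_isPositive _).1 hρ)
    simp only [map_sum, tr_sum, Complex.re_sum]
    refine Finset.sum_le_sum fun i _ => ?_
    rw [tr_apply_rankOne hC, tr_rankOne]
    have hx := ((le_def _ _).1 h).re_inner_nonneg_left (u i)
    rw [_root_.sub_apply, inner_sub_left, map_sub, sub_nonneg] at hx
    exact hx

/-- The operation with effect `E` that prepares the pure state `b` if it succeeds. -/
def measurePrepare (b : K) : Operators H →ₗ[ℂ] SuperOp H K where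
  toFun E :=
    { toFun := fun X => tr (E * X) • rankOne ℂ b b
      map_add' := fun X Y => by rw [mul_add, tr_add, add_smul]
      map_smul' := fun c X => by rw [mul_smul_comm, tr_smul, mul_smul, RingHom.id_apply] }
  map_add' E F := by ext1 X; simp [add_mul, tr_add, add_smul]
  map_smul' c E := by ext1 X; simp [tr_smul, mul_smul]

lemma measurePrepare_apply (b : K) (E X : Operators H) :
    measurePrepare b E X = tr (E * X) • rankOne ℂ b b := rfl

lemma choi_measurePrepare_nonneg (b : K) {E : Operators H} (hE : 0 ≤ E) :
    0 ≤ choi (measurePrepare b E) := by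
  obtain ⟨n, u, rfl⟩ := isPositive_iff_eq_sum_rankOne.1 ((nonneg_iff_isPositive _).1 hE)
  simp only [map_sum]
  refine Finset.sum_nonneg fun i _ => ?_
  have : measurePrepare b (rankOne ℂ (u i) (u i)) =
      krausMap (rankOne ℂ b (u i)) (rankOne ℂ b (u i)) := by
    ext1 X
    rw [measurePrepare_apply, krausMap_apply, mul_def, rankOne_comp, tr_rankOne, adjoint_rankOne,
      comp_rankOne, comp_rankOne, rankOne_apply, adjoint_inner_left]
    simp
  rw [this]
  exact choi_krausMap_nonneg _

lemma effect_measurePrepare {b : K} (hb : ‖b‖ = 1) (E : Operators H) :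
    effect (measurePrepare b E) = E := by
  rw [effect_apply]
  conv_rhs => rw [← sum_inner_smul_rankOne E]
  refine Finset.sum_congr rfl fun i _ => Finset.sum_congr rfl fun j _ => ?_
  rw [measurePrepare_apply, tr_smul, tr_rankOne, mul_def, comp_rankOne, tr_rankOne,
    inner_self_eq_norm_sq_to_K, hb]
  simp

lemma exists_smul_mem_operations {Q : SuperOp H K} (hQ : 0 ≤ choi Q) :
    ∃ r : ℝ, 0 < r ∧ (r : ℂ) • Q ∈ operations H K := by
  have hE := effect_nonneg hQ
  have hpos : 0 < ‖effect Q‖ + 1 := by positivity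
  refine ⟨(‖effect Q‖ + 1)⁻¹, by positivity, (mem_operations_iff _).2 ⟨?_, ?_⟩⟩
  · rw [map_smul]
    exact ofReal_smul_nonneg (by positivity) hQ
  · rw [map_smul]
    have h0 : (0 : Operators H) ≤ (‖effect Q‖ + 1)⁻¹ • effect Q :=
      smul_nonneg (by positivity) hE
    refine (CStarAlgebra.norm_le_one_iff_of_nonneg _ h0).1 ?_
    rw [norm_smul, Real.norm_eq_abs, abs_of_pos (by positivity), inv_mul_le_iff₀ hpos]
    linarith

lemma zero_mem_operations : (0 : SuperOp H K) ∈ operations H K := by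
  rw [mem_operations_iff, map_zero, map_zero]
  exact ⟨le_rfl, zero_le_one⟩

lemma mix_mem_operations {Q R : SuperOp H K} (hQ : Q ∈ operations H K) (hR : R ∈ operations H K)
    {p : ℝ} (hp : 0 ≤ p) (hp1 : p ≤ 1) :
    (p : ℂ) • Q + ((1 - p : ℝ) : ℂ) • R ∈ operations H K := by
  rw [mem_operations_iff] at *
  have hq : 0 ≤ 1 - p := sub_nonneg.2 hp1
  simp only [map_add, map_smul]
  refine ⟨add_nonneg (ofReal_smul_nonneg hp hQ.1) (ofReal_smul_nonneg hq hR.1), ?_⟩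
  calc p • effect Q + (1 - p) • effect R ≤ p • (1 : Operators H) + (1 - p) • (1 : Operators H) :=
        add_le_add (smul_le_smul_of_nonneg_left hQ.2 hp) (smul_le_smul_of_nonneg_left hR.2 hq)
    _ = 1 := by rw [← add_smul, add_sub_cancel, one_smul]

/-- The completely positive maps span the space of all linear maps `L(H) → L(K)`. -/
lemma linearMap_ext_of_choi_nonneg {W : Type*} [AddCommGroup W] [Module ℂ W]
    {F G : SuperOp H K →ₗ[ℂ] W} (h : ∀ Q, 0 ≤ choi Q → F Q = G Q) : F = G := by
  have hs : F ∘ₗ choi.symm.toLinearMap = G ∘ₗ choi.symm.toLinearMap := by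
    refine LinearMap.ext_on (CStarAlgebra.span_nonneg (A := Operators (ChoiSpace H K))) ?_
    intro X hX
    exact h _ (by rwa [LinearEquiv.coe_coe, LinearEquiv.apply_symm_apply])
  ext1 Q
  simpa using LinearMap.congr_fun hs (choi Q)

end Effect

/-! ### Linear isomorphisms of quantum operations -/

section Symmetry

variable {H₁ H₂ K₁ K₂ : Type*}
    [NormedAddCommGroup H₁] [InnerProductSpace ℂ H₁] [FiniteDimensional ℂ H₁] [CompleteSpace H₁]
    [NormedAddCommGroup H₂] [InnerProductSpace ℂ H₂] [FiniteDimensional ℂ H₂] [CompleteSpace H₂]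
    [NormedAddCommGroup K₁] [InnerProductSpace ℂ K₁] [FiniteDimensional ℂ K₁] [CompleteSpace K₁]
    [NormedAddCommGroup K₂] [InnerProductSpace ℂ K₂] [FiniteDimensional ℂ K₂] [CompleteSpace K₂]

lemma IsOperationSymmetry.exists_linear {S : SuperOp H₁ H₂ → SuperOp K₁ K₂}
    (hS : IsOperationSymmetry S) :
    ∃ T : SuperOp H₁ H₂ →ₗ[ℂ] SuperOp K₁ K₂, ∀ Q ∈ operations H₁ H₂, T Q = S Q := by
  obtain ⟨T, hT⟩ := exists_linear_extension_of_affine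
    {X : Operators (ChoiSpace H₁ H₂) | choi.symm X ∈ operations H₁ H₂} (fun X => S (choi.symm X))
    (by simpa using zero_mem_operations)
    (fun X hX Y hY p hp hp1 => by
      simpa only [Set.mem_ofPred_eq, map_add, map_smul] using mix_mem_operations hX hY hp hp1)
    (fun X hX => by
      obtain ⟨r, hr, h⟩ := exists_smul_mem_operations (Q := choi.symm X)
        (by rwa [LinearEquiv.apply_symm_apply])
      exact ⟨r, hr, by simpa only [Set.mem_ofPred_eq, map_smul] using h⟩)
    (by simpa using hS.map_null)
    (fun X hX Y hY p hp hp1 => by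
      simpa only [map_add, map_smul] using hS.map_mix _ hX _ hY p hp hp1)
    (fun X hX => by simpa using ((mem_operations_iff _).1 hX).1)
  refine ⟨T ∘ₗ choi.toLinearMap, fun Q hQ => ?_⟩
  have := hT (choi Q) (by simpa using hQ)
  simpa using this

lemma IsOperationSymmetry.invFunOn {S : SuperOp H₁ H₂ → SuperOp K₁ K₂}
    (hS : IsOperationSymmetry S) :
    IsOperationSymmetry (Function.invFunOn S (operations H₁ H₂)) := by
  have hinv := hS.bijOn.invOn_invFunOn
  have hbij := hinv.symm.bijOn (hS.bijOn.surjOn.mapsTo_invFunOn) hS.bijOn.mapsTo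
  refine ⟨hbij, fun Q hQ R hR p hp hp1 => ?_, ?_⟩
  · have hQ' := hbij.mapsTo hQ
    have hR' := hbij.mapsTo hR
    have h := hS.map_mix _ hQ' _ hR' p hp hp1
    rw [hinv.2 hQ, hinv.2 hR] at h
    rw [← h, hinv.1 (mix_mem_operations hQ' hR' hp hp1)]
  · have h := hinv.1 (zero_mem_operations (H := H₁) (K := H₂))
    rwa [hS.map_null] at h

lemma linearMap_ext_of_eqOn_operations {W : Type*} [AddCommGroup W] [Module ℂ W]
    {F G : SuperOp H₁ H₂ →ₗ[ℂ] W} (h : ∀ Q ∈ operations H₁ H₂, F Q = G Q) : F = G := by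
  refine linearMap_ext_of_choi_nonneg fun Q hQ => ?_
  obtain ⟨r, hr, hrQ⟩ := exists_smul_mem_operations hQ
  have := h _ hrQ
  rw [map_smul, map_smul] at this
  exact smul_right_injective W (by exact_mod_cast hr.ne' : (r : ℂ) ≠ 0) this

/-- A linear isomorphism that maps the quantum operations onto the quantum operations. -/
def IsOperationIso (T : SuperOp H₁ H₂ ≃ₗ[ℂ] SuperOp K₁ K₂) : Prop :=
  ∀ Q, T Q ∈ operations K₁ K₂ ↔ Q ∈ operations H₁ H₂

lemma IsOperationIso.symm {T : SuperOp H₁ H₂ ≃ₗ[ℂ] SuperOp K₁ K₂} (hT : IsOperationIso T) :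
    IsOperationIso T.symm := fun Q => by rw [← hT, T.apply_symm_apply]

lemma IsOperationSymmetry.exists_linearEquiv {S : SuperOp H₁ H₂ → SuperOp K₁ K₂}
    (hS : IsOperationSymmetry S) :
    ∃ T : SuperOp H₁ H₂ ≃ₗ[ℂ] SuperOp K₁ K₂, IsOperationIso T ∧
      ∀ Q ∈ operations H₁ H₂, T Q = S Q := by
  obtain ⟨T, hT⟩ := hS.exists_linear
  obtain ⟨T', hT'⟩ := hS.invFunOn.exists_linear
  have hinv := hS.bijOn.invOn_invFunOn
  have hT1 : ∀ Q ∈ operations H₁ H₂, T Q ∈ operations K₁ K₂ := fun Q hQ => by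
    rw [hT Q hQ]; exact hS.bijOn.mapsTo hQ
  have hT2 : ∀ Q ∈ operations K₁ K₂, T' Q ∈ operations H₁ H₂ := fun Q hQ => by
    rw [hT' Q hQ]; exact hS.invFunOn.bijOn.mapsTo hQ
  have h1 : T ∘ₗ T' = LinearMap.id := linearMap_ext_of_eqOn_operations fun Q hQ => by
    rw [LinearMap.comp_apply, LinearMap.id_apply, hT _ (hT2 Q hQ), hT' Q hQ, hinv.2 hQ]
  have h2 : T' ∘ₗ T = LinearMap.id := linearMap_ext_of_eqOn_operations fun Q hQ => by
    rw [LinearMap.comp_apply, LinearMap.id_apply, hT' _ (hT1 Q hQ), hT Q hQ, hinv.1 hQ]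
  refine ⟨.ofLinearMap T T' h1 h2, fun Q => ⟨fun h => ?_, hT1 Q⟩, hT⟩
  have := hT2 _ h
  rwa [LinearEquiv.coe_ofLinearMap, ← LinearMap.comp_apply, h2] at this

lemma IsOperationIso.choi_nonneg {T : SuperOp H₁ H₂ ≃ₗ[ℂ] SuperOp K₁ K₂} (hT : IsOperationIso T)
    {Q : SuperOp H₁ H₂} (hQ : 0 ≤ choi Q) : 0 ≤ choi (T Q) := by
  obtain ⟨r, hr, hrQ⟩ := exists_smul_mem_operations hQ
  have h := ofReal_smul_nonneg (inv_nonneg.2 hr.le) ((mem_operations_iff _).1 ((hT _).2 hrQ)).1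
  rwa [← map_smul choi, ← map_smul T, smul_smul, ← Complex.ofReal_mul, inv_mul_cancel₀ hr.ne',
    Complex.ofReal_one, one_smul] at h

lemma IsOperationIso.isOrderIso {T : SuperOp H₁ H₂ ≃ₗ[ℂ] SuperOp K₁ K₂} (hT : IsOperationIso T) :
    IsOrderIso (choi.symm ≪≫ₗ T ≪≫ₗ choi) := fun X => by
  change 0 ≤ choi (T (choi.symm X)) ↔ 0 ≤ X
  constructor
  · intro h
    have := hT.symm.choi_nonneg h
    rwa [T.symm_apply_apply, LinearEquiv.apply_symm_apply] at this
  · intro h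
    exact hT.choi_nonneg (by rwa [LinearEquiv.apply_symm_apply])

/-- Operations with equal effects have images with equal effects: the effect of `T Q` is
determined by the operations that may be added to `T Q`, and these correspond to the operations
that may be added to `Q`. -/
lemma IsOperationIso.effect_le [Nontrivial K₂] {T : SuperOp H₁ H₂ ≃ₗ[ℂ] SuperOp K₁ K₂}
    (hT : IsOperationIso T) {Q R : SuperOp H₁ H₂} (hQ : Q ∈ operations H₁ H₂)
    (hR : R ∈ operations H₁ H₂) (hQR : effect Q = effect R) : effect (T R) ≤ effect (T Q) := by
  obtain ⟨b, hb⟩ := exists_norm_eq K₂ zero_le_one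
  have hTQ := (mem_operations_iff _).1 ((hT Q).2 hQ)
  -- complete `T Q` to a channel
  set Z := measurePrepare b (1 - effect (T Q))
  have hZ : 0 ≤ choi Z := choi_measurePrepare_nonneg b (sub_nonneg.2 hTQ.2)
  have hZe : effect Z = 1 - effect (T Q) := effect_measurePrepare hb _
  have h1 : T (Q + T.symm Z) ∈ operations K₁ K₂ := by
    rw [map_add, T.apply_symm_apply, mem_operations_iff, map_add, map_add, hZe]
    exact ⟨add_nonneg hTQ.1 hZ, by rw [add_sub_cancel]⟩
  have h2 := (mem_operations_iff _).1 ((hT _).1 h1)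
  have h3 : R + T.symm Z ∈ operations H₁ H₂ := by
    rw [mem_operations_iff, map_add, map_add, ← hQR, ← map_add effect]
    exact ⟨add_nonneg ((mem_operations_iff _).1 hR).1 (hT.symm.choi_nonneg hZ), h2.2⟩
  have h4 := ((mem_operations_iff _).1 ((hT _).2 h3)).2
  rw [map_add, T.apply_symm_apply, map_add, hZe] at h4
  have h5 := sub_nonneg.2 h4
  rw [show 1 - (effect (T R) + (1 - effect (T Q))) = effect (T Q) - effect (T R) by abel] at h5
  exact sub_nonneg.1 h5

/-- The action of an isomorphism of operations on effects, with operations that prepare `b` as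
representatives of the effects. -/
def effectMap (T : SuperOp H₁ H₂ ≃ₗ[ℂ] SuperOp K₁ K₂) (b : H₂) :
    Operators H₁ →ₗ[ℂ] Operators K₁ :=
  effect ∘ₗ T.toLinearMap ∘ₗ measurePrepare b

lemma IsOperationIso.effect_map [Nontrivial K₂] {T : SuperOp H₁ H₂ ≃ₗ[ℂ] SuperOp K₁ K₂}
    (hT : IsOperationIso T) {b : H₂} (hb : ‖b‖ = 1) (Q : SuperOp H₁ H₂) :
    effect (T Q) = effectMap T b (effect Q) := by
  have h : effect ∘ₗ T.toLinearMap = effectMap T b ∘ₗ effect := by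
    refine linearMap_ext_of_eqOn_operations fun Q hQ => ?_
    have hQ' := (mem_operations_iff _).1 hQ
    have hR : measurePrepare b (effect Q) ∈ operations H₁ H₂ := by
      rw [mem_operations_iff, effect_measurePrepare hb]
      exact ⟨choi_measurePrepare_nonneg b (effect_nonneg hQ'.1), hQ'.2⟩
    have he := effect_measurePrepare hb (effect Q)
    exact le_antisymm (hT.effect_le hR hQ he) (hT.effect_le hQ hR he.symm)
  exact LinearMap.congr_fun h Q

lemma IsOperationIso.effectMap_nonneg {T : SuperOp H₁ H₂ ≃ₗ[ℂ] SuperOp K₁ K₂}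
    (hT : IsOperationIso T) (b : H₂) {E : Operators H₁} (hE : 0 ≤ E) : 0 ≤ effectMap T b E :=
  effect_nonneg (hT.choi_nonneg (choi_measurePrepare_nonneg b hE))

lemma IsOperationIso.effectMap_one_le {T : SuperOp H₁ H₂ ≃ₗ[ℂ] SuperOp K₁ K₂}
    (hT : IsOperationIso T) {b : H₂} (hb : ‖b‖ = 1) : effectMap T b 1 ≤ 1 := by
  refine ((mem_operations_iff _).1 ((hT _).2 ((mem_operations_iff _).2 ⟨?_, ?_⟩))).2
  · exact choi_measurePrepare_nonneg b zero_le_one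
  · rw [effect_measurePrepare hb]

lemma IsOperationIso.effectMap_effectMap [Nontrivial H₂]
    {T : SuperOp H₁ H₂ ≃ₗ[ℂ] SuperOp K₁ K₂} (hT : IsOperationIso T) {b : H₂}
    (hb : ‖b‖ = 1) {c : K₂} (hc : ‖c‖ = 1) (E : Operators H₁) :
    effectMap T.symm c (effectMap T b E) = E := by
  have h := hT.symm.effect_map hc (T (measurePrepare b E))
  rw [T.symm_apply_apply, effect_measurePrepare hb] at h
  exact h.symm

/-- An isomorphism of operations induces a unital order isomorphism of effects. -/
lemma IsOperationIso.exists_effect_iso [Nontrivial H₂] [Nontrivial K₂]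
    {T : SuperOp H₁ H₂ ≃ₗ[ℂ] SuperOp K₁ K₂} (hT : IsOperationIso T) :
    ∃ τ : Operators H₁ ≃ₗ[ℂ] Operators K₁, IsOrderIso τ ∧ τ 1 = 1 ∧
      ∀ Q, effect (T Q) = τ (effect Q) := by
  obtain ⟨b, hb⟩ := exists_norm_eq H₂ zero_le_one
  obtain ⟨c, hc⟩ := exists_norm_eq K₂ zero_le_one
  have h1 := hT.effectMap_effectMap hb hc
  have h2 := hT.symm.effectMap_effectMap hc hb
  let τ : Operators H₁ ≃ₗ[ℂ] Operators K₁ :=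
    .ofLinearMap (effectMap T b) (effectMap T.symm c) (LinearMap.ext h2) (LinearMap.ext h1)
  have hτ : IsOrderIso τ := fun E => by
    refine ⟨fun h => ?_, hT.effectMap_nonneg b⟩
    have := hT.symm.effectMap_nonneg c h
    rwa [LinearEquiv.coe_ofLinearMap, h1] at this
  refine ⟨τ, hτ, le_antisymm (hT.effectMap_one_le hb) ?_, hT.effect_map hb⟩
  have h := (hτ.le_iff _ _).2 (hT.symm.effectMap_one_le hc)
  rwa [show τ (effectMap T.symm c 1) = 1 from h2 1] at h

lemma nontrivial_of_linearEquiv [Nontrivial H₁] [Nontrivial H₂]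
    (T : SuperOp H₁ H₂ ≃ₗ[ℂ] SuperOp K₁ K₂) : Nontrivial K₂ := by
  by_contra h
  rw [not_nontrivial_iff_subsingleton] at h
  obtain ⟨b, hb⟩ := exists_norm_eq H₂ zero_le_one
  have hsub : T (measurePrepare b 1) = T 0 := by
    ext X y
    exact Subsingleton.elim _ _
  have h1 := congrArg effect (T.injective hsub)
  rw [effect_measurePrepare hb, map_zero] at h1
  exact one_ne_zero h1

end Symmetry

/-! ### Polarisation of norm-preserving biadditive maps -/

section Biadditive

variable {H₁ H₂ K₁ K₂ : Type*}
    [NormedAddCommGroup H₁] [InnerProductSpace ℂ H₁] [FiniteDimensional ℂ H₁] [CompleteSpace H₁]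
    [NormedAddCommGroup H₂] [InnerProductSpace ℂ H₂] [FiniteDimensional ℂ H₂] [CompleteSpace H₂]
    [NormedAddCommGroup K₁] [InnerProductSpace ℂ K₁] [FiniteDimensional ℂ K₁] [CompleteSpace K₁]
    [NormedAddCommGroup K₂] [InnerProductSpace ℂ K₂] [FiniteDimensional ℂ K₂] [CompleteSpace K₂]

lemma re_inner_of_norm {x y : K₂} {x' y' : H₂} (hx : ‖x‖ = ‖x'‖) (hy : ‖y‖ = ‖y'‖)
    (hxy : ‖x + y‖ = ‖x' + y'‖) : (inner ℂ x y).re = (inner ℂ x' y').re := by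
  have h1 := re_inner_eq_norm_add_mul_self_sub_norm_mul_self_sub_norm_mul_self_div_two (𝕜 := ℂ) x y
  have h2 :=
    re_inner_eq_norm_add_mul_self_sub_norm_mul_self_sub_norm_mul_self_div_two (𝕜 := ℂ) x' y'
  rw [hx, hy, hxy, ← h2] at h1
  exact h1

variable {f : (H₁ →L[ℂ] H₂) → H₁ → K₂}

/-- Polarisation of `‖f V x‖ = ‖V x‖` in both arguments. -/
lemma re_inner_biadditive (hV : ∀ V W x, f (V + W) x = f V x + f W x)
    (hx : ∀ V x y, f V (x + y) = f V x + f V y) (hn : ∀ V x, ‖f V x‖ = ‖V x‖)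
    (V W : H₁ →L[ℂ] H₂) (x y : H₁) :
    (inner ℂ (f V x) (f W y)).re + (inner ℂ (f V y) (f W x)).re =
      (inner ℂ (V x) (W y)).re + (inner ℂ (V y) (W x)).re := by
  have h1 : ∀ V x y, (inner ℂ (f V x) (f V y)).re = (inner ℂ (V x) (V y)).re := fun V x y =>
    re_inner_of_norm (hn V x) (hn V y) (by rw [← hx, hn, map_add])
  have h2 := h1 (V + W) x y
  rw [hV, hV, _root_.add_apply, _root_.add_apply] at h2
  simp only [inner_add_left, inner_add_right, Complex.add_re, h1] at h2
  have h3 : (inner ℂ (f W x) (f V y)).re = (inner ℂ (f V y) (f W x)).re :=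
    inner_re_symm (𝕜 := ℂ) _ _
  have h4 : (inner ℂ (W x) (V y)).re = (inner ℂ (V y) (W x)).re :=
    inner_re_symm (𝕜 := ℂ) _ _
  rw [h3, h4] at h2
  linarith

/-- If `f` has the same type of linearity (linear or antilinear) in both arguments, then it
preserves real parts of inner products. -/
lemma re_inner_of_same_type (hV : ∀ V W x, f (V + W) x = f V x + f W x)
    (hx : ∀ V x y, f V (x + y) = f V x + f V y) (hn : ∀ V x, ‖f V x‖ = ‖V x‖) {s : ℂ}
    (hs : s = Complex.I ∨ s = -Complex.I) (hVI : ∀ V x, f (Complex.I • V) x = s • f V x)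
    (hxI : ∀ V x, f V (Complex.I • x) = s • f V x) (V W : H₁ →L[ℂ] H₂) (x y : H₁) :
    (inner ℂ (f V x) (f W y)).re = (inner ℂ (V x) (W y)).re := by
  have h1 := re_inner_biadditive hV hx hn V W x y
  have h2 := re_inner_biadditive hV hx hn (Complex.I • V) W x (Complex.I • y)
  rcases hs with rfl | rfl <;>
  · simp only [hVI, hxI, _root_.smul_apply, map_smul, inner_smul_left, inner_smul_right,
      Complex.conj_I, map_neg, neg_neg, ← mul_assoc, Complex.I_mul_I, neg_mul, mul_neg, one_mul,
      Complex.neg_re, smul_smul, map_one] at h2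
    linarith

/-- If `f` is linear in one argument and antilinear in the other, then its arguments `x`, `y` are
exchanged. -/
lemma re_inner_of_mixed_type (hV : ∀ V W x, f (V + W) x = f V x + f W x)
    (hx : ∀ V x y, f V (x + y) = f V x + f V y) (hn : ∀ V x, ‖f V x‖ = ‖V x‖) {s : ℂ}
    (hs : s = Complex.I ∨ s = -Complex.I) (hVI : ∀ V x, f (Complex.I • V) x = s • f V x)
    (hxI : ∀ V x, f V (Complex.I • x) = -s • f V x) (V W : H₁ →L[ℂ] H₂) (x y : H₁) :
    (inner ℂ (f V y) (f W x)).re = (inner ℂ (V x) (W y)).re := by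
  have h1 := re_inner_biadditive hV hx hn V W x y
  have h2 := re_inner_biadditive hV hx hn (Complex.I • V) W x (Complex.I • y)
  rcases hs with rfl | rfl <;>
  · simp only [hVI, hxI, _root_.smul_apply, map_smul, inner_smul_left, inner_smul_right,
      Complex.conj_I, map_neg, neg_neg, ← mul_assoc, Complex.I_mul_I, neg_mul, mul_neg, one_mul,
      Complex.neg_re, smul_smul, map_one] at h2
    linarith

/-- The mixed case occurs only if `H₁` is a line. -/
lemma norm_apply_of_mixed_type [Nontrivial H₁] [Nontrivial H₂]
    (hV : ∀ V W x, f (V + W) x = f V x + f W x)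
    (hx : ∀ V x y, f V (x + y) = f V x + f V y) (hn : ∀ V x, ‖f V x‖ = ‖V x‖) {s : ℂ}
    (hs : s = Complex.I ∨ s = -Complex.I) (hVI : ∀ V x, f (Complex.I • V) x = s • f V x)
    (hxI : ∀ V x, f V (Complex.I • x) = -s • f V x) {x y : H₁} (hxy : ‖x‖ = ‖y‖)
    (V : H₁ →L[ℂ] H₂) : ‖V x‖ = ‖V y‖ := by
  obtain ⟨a, ha⟩ := exists_norm_eq H₁ zero_le_one
  obtain ⟨b, hb⟩ := exists_norm_eq H₂ zero_le_one
  have haa : inner ℂ a a = 1 := by rw [inner_self_eq_norm_sq_to_K, ha]; simp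
  have hbb : inner ℂ b b = 1 := by rw [inner_self_eq_norm_sq_to_K, hb]; simp
  have hline : ∀ x : H₁, x = inner ℂ a x • a := by
    intro x
    set z := x - inner ℂ a x • a with hz
    have haz : inner ℂ a z = 0 := by rw [hz, inner_sub_right, inner_smul_right, haa]; simp
    have h := re_inner_of_mixed_type hV hx hn hs hVI hxI (rankOne ℂ b a) (rankOne ℂ b z) a z
    have h0 : f (rankOne ℂ b a) z = 0 := by
      rw [← norm_eq_zero, hn, rankOne_apply, haz, zero_smul, norm_zero]
    rw [h0, inner_zero_left, rankOne_apply, rankOne_apply, haa, one_smul, inner_smul_right, hbb,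
      mul_one] at h
    have hz0 : z = 0 := by
      rw [← norm_eq_zero, ← sq_eq_zero_iff, ← inner_self_eq_norm_sq (𝕜 := ℂ)]
      exact h.symm
    exact sub_eq_zero.1 hz0
  have hVx : ∀ x, ‖V x‖ = ‖x‖ * ‖V a‖ := by
    intro x
    have h1 := congrArg norm (hline x)
    rw [norm_smul, ha, mul_one] at h1
    conv_lhs => rw [hline x]
    rw [map_smul, norm_smul, h1]
  rw [hVx, hVx y, hxy]

end Biadditive

/-! ### State space symmetries from unitaries and antiunitaries -/

section StateSymmetry

variable {H K : Type*}
    [NormedAddCommGroup H] [InnerProductSpace ℂ H] [FiniteDimensional ℂ H] [CompleteSpace H]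
    [NormedAddCommGroup K] [InnerProductSpace ℂ K] [FiniteDimensional ℂ K] [CompleteSpace K]

/-- The linear extension of an isometric map of pure states preserves states. -/
lemma map_mem_states {F : SuperOp H K} {w : H → K} (hw : ∀ x, ‖w x‖ = ‖x‖)
    (hF : ∀ x, F (rankOne ℂ x x) = rankOne ℂ (w x) (w x)) {ρ : Operators H} (hρ : ρ ∈ states H) :
    F ρ ∈ states K := by
  obtain ⟨h0, h1⟩ := hρ
  obtain ⟨n, v, rfl⟩ := isPositive_iff_eq_sum_rankOne.1 ((nonneg_iff_isPositive _).1 h0)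
  refine ⟨?_, ?_⟩
  · rw [map_sum]
    exact Finset.sum_nonneg fun i _ => by rw [hF]; exact rankOne_self_nonneg _
  · rw [← h1]
    simp only [map_sum, tr_sum, hF, tr_rankOne, inner_self_eq_norm_sq_to_K, hw]

lemma isStateSymmetry_of_rankOne {F : SuperOp H K} {F' : SuperOp K H} {w : H → K} {w' : K → H}
    (hw : ∀ x, ‖w x‖ = ‖x‖) (hw' : ∀ x, ‖w' x‖ = ‖x‖)
    (hF : ∀ x, F (rankOne ℂ x x) = rankOne ℂ (w x) (w x))
    (hF' : ∀ x, F' (rankOne ℂ x x) = rankOne ℂ (w' x) (w' x))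
    (h : ∀ X, F' (F X) = X) (h' : ∀ X, F (F' X) = X) : IsStateSymmetry F where
  bijOn := Set.InvOn.bijOn ⟨fun X _ => h X, fun X _ => h' X⟩
    (fun _ => map_mem_states hw hF) (fun _ => map_mem_states hw' hF')
  map_mix ρ _ σ _ p _ _ := by rw [map_add, map_smul, map_smul]

/-- Conjugation with a unitary, as a linear map. -/
def unitaryConjₗ (U : H ≃ₗᵢ[ℂ] K) : SuperOp H K := krausMap (U : H →L[ℂ] K) (U : H →L[ℂ] K)

lemma unitaryConjₗ_eq (U : H ≃ₗᵢ[ℂ] K) (X : Operators H) :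
    unitaryConjₗ U X = unitaryConj U X := rfl

lemma unitaryConj_apply (U : H ≃ₗᵢ[ℂ] K) (X : Operators H) (y : K) :
    unitaryConj U X y = U (X (U.symm y)) := by
  rw [unitaryConj, U.adjoint_eq_symm]
  rfl

lemma unitaryConjₗ_rankOne (U : H ≃ₗᵢ[ℂ] K) (x : H) :
    unitaryConjₗ U (rankOne ℂ x x) = rankOne ℂ (U x) (U x) := krausMap_rankOne _ _ _ _

lemma isStateSymmetry_unitaryConjₗ (U : H ≃ₗᵢ[ℂ] K) : IsStateSymmetry (unitaryConjₗ U) := by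
  refine isStateSymmetry_of_rankOne (F' := unitaryConjₗ U.symm) U.norm_map U.symm.norm_map
    (unitaryConjₗ_rankOne U) (unitaryConjₗ_rankOne U.symm) (fun X => ?_) (fun X => ?_)
  · ext y; simp [unitaryConjₗ_eq, unitaryConj_apply]
  · ext y; simp [unitaryConjₗ_eq, unitaryConj_apply]

lemma isUnitaryOnStates_unitaryConjₗ (U : H ≃ₗᵢ[ℂ] K) : IsUnitaryOnStates (unitaryConjₗ U) :=
  ⟨U, fun _ _ => unitaryConjₗ_eq U _⟩

lemma isStateSymmetry_antiConj (j : H ≃ₗᵢ⋆[ℂ] K) : IsStateSymmetry (antiConj j) :=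
  isStateSymmetry_of_rankOne (F' := antiConj j.symm) j.norm_map j.symm.norm_map
    (fun x => antiConj_rankOne j x x) (fun x => antiConj_rankOne j.symm x x)
    (antiConj_antiConj_symm j.symm) (antiConj_antiConj_symm j)

lemma transposeIn_eq_antiConj {ι : Type*} [Fintype ι] [DecidableEq ι] (b : OrthonormalBasis ι ℂ H)
    (X : Operators H) : transposeIn b X = antiConj (basisConj b) X := by
  have hb : ∀ i, basisConj b (b i) = b i := fun i => by
    rw [basisConj_apply]
    simp [orthonormal_iff_ite.1 b.orthonormal]
  refine ContinuousLinearMap.coe_injective (b.toBasis.ext fun j => ?_)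
  have h1 : transposeIn b X (b j) = ∑ i, inner ℂ (b j) (X (b i)) • b i := by
    change Matrix.toLin b.toBasis b.toBasis _ (b j) = _
    rw [← b.coe_toBasis, Matrix.toLin_self]
    simp [LinearMap.toMatrix_apply, b.repr_apply_apply]
  rw [b.coe_toBasis]
  change transposeIn b X (b j) = antiConj (basisConj b) X (b j)
  rw [h1, antiConj_apply, basisConj_symm, hb, basisConj_apply]
  simp only [star_eq_adjoint, adjoint_inner_left]

lemma isAntiunitaryOnStates_antiConj (j : H ≃ₗᵢ⋆[ℂ] K) : IsAntiunitaryOnStates (antiConj j) := by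
  intro b
  refine ⟨(basisConj b).trans j, fun ρ _ => ?_⟩
  ext y
  rw [transposeIn_eq_antiConj, unitaryConj_apply, antiConj_apply, antiConj_apply]
  have hc : ∀ x, basisConj b (basisConj b x) = x := (basisConj b).apply_symm_apply
  change _ = j (basisConj b (basisConj b (star ρ (basisConj b (basisConj b (j.symm y))))))
  rw [hc, hc]

/-- A linear map of operators is determined by its values on the operators `|x⟩⟨x|`. -/
lemma superOp_ext_rankOne {F G : SuperOp H K}
    (h : ∀ x, F (rankOne ℂ x x) = G (rankOne ℂ x x)) : F = G := by
  refine LinearMap.ext_on (CStarAlgebra.span_nonneg (A := Operators H)) fun X hX => ?_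
  obtain ⟨n, v, rfl⟩ := isPositive_iff_eq_sum_rankOne.1 ((nonneg_iff_isPositive _).1 hX)
  simp only [map_sum, h]

end StateSymmetry

/-! ### Factorisation of isomorphisms of quantum operations -/

section Factorisation

variable {H₁ H₂ K₁ K₂ : Type*}
    [NormedAddCommGroup H₁] [InnerProductSpace ℂ H₁] [FiniteDimensional ℂ H₁] [CompleteSpace H₁]
    [NormedAddCommGroup H₂] [InnerProductSpace ℂ H₂] [FiniteDimensional ℂ H₂] [CompleteSpace H₂]
    [NormedAddCommGroup K₁] [InnerProductSpace ℂ K₁] [FiniteDimensional ℂ K₁] [CompleteSpace K₁]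
    [NormedAddCommGroup K₂] [InnerProductSpace ℂ K₂] [FiniteDimensional ℂ K₂] [CompleteSpace K₂]

/-- A map of Kraus operators that is isometric along `u` acts by composition with `u⁻¹` and with
an isometry `U` of the output spaces. -/
lemma exists_output_isometry [Nontrivial H₁] {σ : ℂ →+* ℂ}
    (hσ : σ = RingHom.id ℂ ∨ σ = starRingEnd ℂ)
    (A : (H₁ →L[ℂ] H₂) →ₛₗ[σ] (K₁ →L[ℂ] K₂)) (hA : Function.Surjective A) (u : H₁ →ₛₗ[σ] K₁)
    (hu : ∀ x, ‖u x‖ = ‖x‖) (hn : ∀ V x, ‖A V (u x)‖ = ‖V x‖) :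
    ∃ U : H₂ →ₛₗ[σ] K₂, Function.Surjective U ∧ (∀ y, ‖U y‖ = ‖y‖) ∧
      ∀ V x, A V (u x) = U (V x) := by
  obtain ⟨a, ha⟩ := exists_norm_eq H₁ zero_le_one
  have haa : inner ℂ a a = 1 := by rw [inner_self_eq_norm_sq_to_K, ha]; simp
  have hs : σ Complex.I = Complex.I ∨ σ Complex.I = -Complex.I := by
    rcases hσ with rfl | rfl <;> simp
  have hinner := re_inner_of_same_type (f := fun V x => A V (u x)) (fun V W x => by simp)
    (fun V x y => by simp) hn hs (fun V x => by simp) (fun V x => by simp)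
  -- `b = V a` for `V = |b⟩⟨a|`, which forces the value of `U b`
  let U : H₂ →ₛₗ[σ] K₂ :=
    { toFun := fun b => A (rankOne ℂ b a) (u a)
      map_add' := fun b c => by simp
      map_smul' := fun c b => by simp }
  have hr : ∀ b : H₂, rankOne ℂ b a a = b := fun b => by rw [rankOne_apply, haa, one_smul]
  have hUn : ∀ y, ‖U y‖ = ‖y‖ := fun y => (hn _ _).trans (by rw [hr])
  have hU : ∀ V x, A V (u x) = U (V x) := by
    intro V x
    -- `‖A V (u x) - U (V x)‖²` expands to inner products that `hn` and `hinner` evaluate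
    rw [← sub_eq_zero, ← norm_eq_zero, ← sq_eq_zero_iff, norm_sub_sq (𝕜 := ℂ), hn, hUn]
    have h := hinner V (rankOne ℂ (V x) a) x a
    rw [hr] at h
    change ‖V x‖ ^ 2 - 2 * (inner ℂ (A V (u x)) (A (rankOne ℂ (V x) a) (u a))).re + _ = 0
    have h' : (inner ℂ (V x) (V x)).re = ‖V x‖ ^ 2 := inner_self_eq_norm_sq (𝕜 := ℂ) _
    rw [h, h']
    ring
  refine ⟨U, fun k => ?_, hUn, hU⟩
  obtain ⟨V, hV⟩ := hA (rankOne ℂ k (u a))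
  refine ⟨V a, ?_⟩
  rw [← hU, hV, rankOne_apply, inner_self_eq_norm_sq_to_K, hu, ha]
  simp

lemma norm_inner_semilinear {σ : ℂ →+* ℂ} (hσ : σ = RingHom.id ℂ ∨ σ = starRingEnd ℂ)
    {u : H₁ →ₛₗ[σ] K₁} (hub : Function.Bijective u) (hu : ∀ x, ‖u x‖ = ‖x‖) (x y : H₁) :
    ‖inner ℂ (u x) (u y)‖ = ‖inner ℂ x y‖ := by
  rcases hσ with rfl | rfl
  · exact congrArg norm (LinearIsometry.inner_map_map ⟨u, hu⟩ x y)
  · rw [norm_inner_symm x y]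
    exact congrArg norm (inner_antiunitary (LinearIsometryEquiv.ofSurjective ⟨u, hu⟩ hub.2) x y)

/-- An isomorphism of operations acts on Kraus operators by an invertible linear or antilinear
map. -/
lemma IsOperationIso.exists_kraus_map {T : SuperOp H₁ H₂ ≃ₗ[ℂ] SuperOp K₁ K₂}
    (hT : IsOperationIso T) :
    ∃ σ : ℂ →+* ℂ, (σ = RingHom.id ℂ ∨ σ = starRingEnd ℂ) ∧
      ∃ A : (H₁ →L[ℂ] H₂) →ₛₗ[σ] (K₁ →L[ℂ] K₂), Function.Bijective A ∧
        ∀ V, T (krausMap V V) = krausMap (A V) (A V) := by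
  obtain ⟨σ, hσ, B, hB, hTB⟩ := hT.isOrderIso.exists_semilinear
  refine ⟨σ, hσ, choiVec.symm.toLinearMap.comp (B.comp choiVec.toLinearMap),
    choiVec.symm.bijective.comp (hB.comp choiVec.bijective), fun V => choi.injective ?_⟩
  have h := hTB (choiVec V)
  rw [← choi_krausMap] at h
  simp only [LinearEquiv.trans_apply, LinearEquiv.symm_apply_apply] at h
  rw [h, choi_krausMap]
  simp

lemma norm_apply_of_effect {T : SuperOp H₁ H₂ ≃ₗ[ℂ] SuperOp K₁ K₂}
    {τ : Operators H₁ ≃ₗ[ℂ] Operators K₁} (hτ : ∀ Q, effect (T Q) = τ (effect Q))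
    {V : H₁ →L[ℂ] H₂} {V' : K₁ →L[ℂ] K₂} (hV : T (krausMap V V) = krausMap V' V') {u : H₁ → K₁}
    (hu : ∀ x y, ‖inner ℂ (u x) (u y)‖ = ‖inner ℂ x y‖)
    (hτu : ∀ x, τ (rankOne ℂ x x) = rankOne ℂ (u x) (u x)) (x : H₁) :
    ‖V' (u x)‖ = ‖V x‖ := by
  have h1 := hτ (krausMap V V)
  rw [hV, effect_krausMap, effect_krausMap] at h1
  obtain ⟨n, w, hw⟩ := isPositive_iff_eq_sum_rankOne.1 (isPositive_adjoint_comp_self V)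
  have h2 : inner ℂ ((adjoint V' ∘L V') (u x)) (u x) = inner ℂ ((adjoint V ∘L V) x) x := by
    rw [h1, hw, map_sum, _root_.sum_apply, _root_.sum_apply, sum_inner, sum_inner]
    refine Finset.sum_congr rfl fun i _ => ?_
    rw [hτu, inner_left_rankOne_apply, inner_left_rankOne_apply,
      ← inner_conj_symm (u (w i)), ← inner_conj_symm (w i), RCLike.mul_conj, RCLike.mul_conj, hu]
  rw [ContinuousLinearMap.comp_apply, ContinuousLinearMap.comp_apply, adjoint_inner_left,
    adjoint_inner_left, inner_self_eq_norm_sq_to_K, inner_self_eq_norm_sq_to_K] at h2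
  exact (sq_eq_sq₀ (norm_nonneg _) (norm_nonneg _)).1 (by exact_mod_cast h2)

/-- An isomorphism of operations acts as `A V (u x) = U (V x)` on Kraus operators, with `A`, `u`
and `U` all linear or all antilinear. -/
lemma IsOperationIso.exists_factorisation [Nontrivial H₁] [Nontrivial H₂]
    {T : SuperOp H₁ H₂ ≃ₗ[ℂ] SuperOp K₁ K₂} (hT : IsOperationIso T) :
    ∃ σ : ℂ →+* ℂ, (σ = RingHom.id ℂ ∨ σ = starRingEnd ℂ) ∧
      ∃ (A : (H₁ →L[ℂ] H₂) →ₛₗ[σ] (K₁ →L[ℂ] K₂)) (u : H₁ →ₛₗ[σ] K₁) (U : H₂ →ₛₗ[σ] K₂),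
        (∀ V, T (krausMap V V) = krausMap (A V) (A V)) ∧
        Function.Surjective u ∧ (∀ x, ‖u x‖ = ‖x‖) ∧
        Function.Surjective U ∧ (∀ y, ‖U y‖ = ‖y‖) ∧ ∀ V x, A V (u x) = U (V x) := by
  have : Nontrivial K₂ := nontrivial_of_linearEquiv T
  obtain ⟨τ, hτ, hτ1, hτT⟩ := hT.exists_effect_iso
  obtain ⟨σ, hσ, A, hA, hTA⟩ := hT.exists_kraus_map
  obtain ⟨σ', hσ', u, hub, hun, hτu⟩ := hτ.exists_isometry hτ1
  have hn : ∀ V x, ‖A V (u x)‖ = ‖V x‖ := fun V x =>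
    norm_apply_of_effect hτT (hTA V) (norm_inner_semilinear hσ' hub hun) hτu x
  have hs : σ Complex.I = Complex.I ∨ σ Complex.I = -Complex.I := by
    rcases hσ with rfl | rfl <;> simp
  have hfinish : ∀ u' : H₁ →ₛₗ[σ] K₁, Function.Surjective u' → (∀ x, ‖u' x‖ = ‖x‖) →
      (∀ V x, ‖A V (u' x)‖ = ‖V x‖) →
      ∃ (A : (H₁ →L[ℂ] H₂) →ₛₗ[σ] (K₁ →L[ℂ] K₂)) (u : H₁ →ₛₗ[σ] K₁) (U : H₂ →ₛₗ[σ] K₂),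
        (∀ V, T (krausMap V V) = krausMap (A V) (A V)) ∧
        Function.Surjective u ∧ (∀ x, ‖u x‖ = ‖x‖) ∧
        Function.Surjective U ∧ (∀ y, ‖U y‖ = ‖y‖) ∧ ∀ V x, A V (u x) = U (V x) := by
    intro u' hu' hu'n hn'
    obtain ⟨U, hU, hUn, hAU⟩ := exists_output_isometry hσ A hA.surjective u' hu'n hn'
    exact ⟨A, u', U, hTA, hu', hu'n, hU, hUn, hAU⟩
  let c := basisConj (stdOrthonormalBasis ℂ H₁)
  -- in the mixed case `H₁` is a line, on which a conjugation is invisible, so that the type of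
  -- `u` may be changed
  have hmixed : σ' Complex.I = -σ Complex.I → ∀ V x, ‖A V (u (c x))‖ = ‖V x‖ := by
    intro hσσ' V x
    rw [hn]
    exact norm_apply_of_mixed_type (f := fun V x => A V (u x)) (fun V W x => by simp)
      (fun V x y => by simp) hn hs (fun V x => by simp) (fun V x => by simp [hσσ'])
      (c.norm_map x) V
  refine ⟨σ, hσ, ?_⟩
  rcases hσ with rfl | rfl <;> rcases hσ' with rfl | rfl
  · exact hfinish u hub.surjective hun hn
  · exact hfinish (u.comp c.toLinearEquiv.toLinearMap) (hub.surjective.comp c.surjective)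
      (fun x => (hun _).trans (c.norm_map x)) (hmixed (by simp))
  · exact hfinish (u.comp c.toLinearEquiv.toLinearMap) (hub.surjective.comp c.surjective)
      (fun x => (hun _).trans (c.norm_map x)) (hmixed (by simp))
  · exact hfinish u hub.surjective hun hn

/-- State space symmetries given by `w₁` and `w₂` on pure states turn the Kraus operator `V` into
`w₂ ∘ V ∘ w₁`. -/
lemma comp_krausMap_comp {S₁ : SuperOp K₁ H₁} {S₂ : SuperOp H₂ K₂} {w₁ : K₁ → H₁} {w₂ : H₂ → K₂}
    (h₁ : ∀ x, S₁ (rankOne ℂ x x) = rankOne ℂ (w₁ x) (w₁ x))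
    (h₂ : ∀ x, S₂ (rankOne ℂ x x) = rankOne ℂ (w₂ x) (w₂ x))
    {V : H₁ →L[ℂ] H₂} {V' : K₁ →L[ℂ] K₂} (hV : ∀ x, V' x = w₂ (V (w₁ x))) :
    S₂ ∘ₗ krausMap V V ∘ₗ S₁ = krausMap V' V' := by
  refine superOp_ext_rankOne fun x => ?_
  rw [LinearMap.comp_apply, LinearMap.comp_apply, h₁, krausMap_rankOne, h₂, krausMap_rankOne, hV]

lemma finrank_eq_of_antiunitary (j : H₁ ≃ₗᵢ⋆[ℂ] K₁) :
    Module.finrank ℂ H₁ = Module.finrank ℂ K₁ :=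
  ((basisConj (stdOrthonormalBasis ℂ H₁)).trans j).toLinearEquiv.finrank_eq

end Factorisation

end

end QuantumOp

/-- Wigner's theorem for quantum operations. Only the values of `S` on quantum operations matter.
The linear maps `S₁`, `S₂` are the linear extensions of the two state space symmetries, so that
the composition is meaningful (`Q (S₁ ρ)` is in general only a subnormalised state). -/
theorem theorem3
    {Hin Hout Kin Kout : Type*}
    [NormedAddCommGroup Hin] [InnerProductSpace ℂ Hin] [FiniteDimensional ℂ Hin]
    [CompleteSpace Hin] [Nontrivial Hin]
    [NormedAddCommGroup Hout] [InnerProductSpace ℂ Hout] [FiniteDimensional ℂ Hout]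
    [CompleteSpace Hout] [Nontrivial Hout]
    [NormedAddCommGroup Kin] [InnerProductSpace ℂ Kin] [FiniteDimensional ℂ Kin]
    [CompleteSpace Kin]
    [NormedAddCommGroup Kout] [InnerProductSpace ℂ Kout] [FiniteDimensional ℂ Kout]
    [CompleteSpace Kout]
    (S : QuantumOp.SuperOp Hin Hout → QuantumOp.SuperOp Kin Kout)
    (hS : QuantumOp.IsOperationSymmetry S) :
    (∃ (S₁ : QuantumOp.SuperOp Kin Hin) (S₂ : QuantumOp.SuperOp Hout Kout),
      QuantumOp.IsStateSymmetry S₁ ∧ QuantumOp.IsStateSymmetry S₂ ∧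
      ((QuantumOp.IsUnitaryOnStates S₁ ∧ QuantumOp.IsUnitaryOnStates S₂) ∨
        (QuantumOp.IsAntiunitaryOnStates S₁ ∧ QuantumOp.IsAntiunitaryOnStates S₂)) ∧
      ∀ Q ∈ QuantumOp.operations Hin Hout, S Q = S₂ ∘ₗ Q ∘ₗ S₁) ∧
    Module.finrank ℂ Hin = Module.finrank ℂ Kin ∧
    Module.finrank ℂ Hout = Module.finrank ℂ Kout := by
  obtain ⟨T, hT, hTS⟩ := hS.exists_linearEquiv
  obtain ⟨σ, hσ, A, u, U, hTA, hu, hun, hU, hUn, hAU⟩ := hT.exists_factorisation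
  -- `S` and `S₂ ∘ · ∘ S₁` may be compared on the maps with one Kraus operator
  have hext : ∀ (S₁ : QuantumOp.SuperOp Kin Hin) (S₂ : QuantumOp.SuperOp Hout Kout),
      (∀ V, S₂ ∘ₗ QuantumOp.krausMap V V ∘ₗ S₁ = QuantumOp.krausMap (A V) (A V)) →
      ∀ Q ∈ QuantumOp.operations Hin Hout, S Q = S₂ ∘ₗ Q ∘ₗ S₁ := by
    intro S₁ S₂ h Q hQ
    obtain ⟨n, V, rfl⟩ := QuantumOp.exists_kraus ((QuantumOp.mem_operations_iff Q).1 hQ).1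
    rw [← hTS _ hQ, map_sum]
    ext1 X
    simp only [LinearMap.comp_apply, LinearMap.sum_apply, map_sum]
    exact Finset.sum_congr rfl fun i _ => by
      rw [hTA, ← h, LinearMap.comp_apply, LinearMap.comp_apply]
  rcases hσ with rfl | rfl
  · let u' : Hin ≃ₗᵢ[ℂ] Kin := LinearIsometryEquiv.ofSurjective ⟨u, hun⟩ hu
    let U' : Hout ≃ₗᵢ[ℂ] Kout := LinearIsometryEquiv.ofSurjective ⟨U, hUn⟩ hU
    refine ⟨⟨QuantumOp.unitaryConjₗ u'.symm, QuantumOp.unitaryConjₗ U',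
      QuantumOp.isStateSymmetry_unitaryConjₗ _, QuantumOp.isStateSymmetry_unitaryConjₗ _,
      .inl ⟨QuantumOp.isUnitaryOnStates_unitaryConjₗ _,
        QuantumOp.isUnitaryOnStates_unitaryConjₗ _⟩, hext _ _ fun V => ?_⟩,
      u'.toLinearEquiv.finrank_eq, U'.toLinearEquiv.finrank_eq⟩
    refine QuantumOp.comp_krausMap_comp (w₁ := u'.symm) (w₂ := U')
      (QuantumOp.unitaryConjₗ_rankOne _) (QuantumOp.unitaryConjₗ_rankOne _) fun x => ?_
    obtain ⟨x, rfl⟩ := u'.surjective x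
    rw [u'.symm_apply_apply]
    exact hAU V x
  · let u' : Hin ≃ₗᵢ⋆[ℂ] Kin := LinearIsometryEquiv.ofSurjective ⟨u, hun⟩ hu
    let U' : Hout ≃ₗᵢ⋆[ℂ] Kout := LinearIsometryEquiv.ofSurjective ⟨U, hUn⟩ hU
    refine ⟨⟨QuantumOp.antiConj u'.symm, QuantumOp.antiConj U',
      QuantumOp.isStateSymmetry_antiConj _, QuantumOp.isStateSymmetry_antiConj _,
      .inr ⟨QuantumOp.isAntiunitaryOnStates_antiConj _,
        QuantumOp.isAntiunitaryOnStates_antiConj _⟩, hext _ _ fun V => ?_⟩,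
      QuantumOp.finrank_eq_of_antiunitary u', QuantumOp.finrank_eq_of_antiunitary U'⟩
    refine QuantumOp.comp_krausMap_comp (w₁ := u'.symm) (w₂ := U')
      (fun x => QuantumOp.antiConj_rankOne _ _ _) (fun x => QuantumOp.antiConj_rankOne _ _ _)
      fun x => ?_
    obtain ⟨x, rfl⟩ := u'.surjective x
    rw [u'.symm_apply_apply]
    exact hAU V x
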